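/- Let $\mathbb{D}=\{z\in\mathbb{C}:|z|<1\}$. For $1\le p<\infty$ and $\beta>-1$, let $H^p$ be the Hardy space of $\mathbb{D}$, with norm $$\|f\|_{H^p}=\sup_{0\le\rho<1}\Big(\frac1{2\pi}\int_0^{2\pi}|f(\rho e^{i\theta})|^p\,d\theta\Big)^{1/p},$$ let $A^p(\beta)$ be the space of the holomorphic functions $f$ on $\mathbb{D}$ with $$\|f\|_{A^p(\beta)}=\Big(\int_{\mathbb{D}}|f(z)|^p(1-|z|^2)^\beta\,d\mathcal{A}(z)\Big)^{1/p}<\infty,$$ where $\mathcal{A}$ is the area measure normalized by $\mathcal{A}(\mathbb{D})=1$, and let $H^\infty$ be the space of bounded holomorphic functions on $\mathbb{D}$ with the supremum norm. For $X=H^p$ or $X=A^p(\beta)$ and a finite sequence $\sigma=(\lambda_1,\dots,\lambda_n)\in\mathbb{D}^n$ put $$c(\sigma,X,H^\infty)=\sup_{f\in X,\ \|f\|_X\le1}\ \inf\{\|g\|_\infty:\ g\in H^\infty,\ g|_\sigma=f|_\sigma\},$$ where $g|_\sigma=f|_\sigma$ means that $f-g$ vanishes at each point $\lambda$ of $\sigma$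 to order at least the multiplicity of $\lambda$ in $\sigma$. For $n\ge1$ and $r\in[0,1)$ put $$C_{n,r}(X,H^\infty)=\sup\{c(\sigma,X,H^\infty):\ \sigma\in\mathbb{D}^n,\ \max_i|\lambda_i|\le r\}.$$ For $\lambda\in\mathbb{D}$ let $\sigma_{n,\lambda}=(\lambda,\dots,\lambda)\in\mathbb{D}^n$, and for $t\in[0,1)$ let $\varphi_X(t)=\sup\{|f(t)|:f\in X,\ \|f\|_X\le1\}$ be the norm of the evaluation functional at $t$. **Theorem.** (1) For every $p\in[1,\infty)$ there are constants $a,b>0$ depending only on $p$ such that, for all $n\ge1$, $r\in[0,1)$, $$a\Big(\frac{n}{1-r}\Big)^{1/p}\le C_{n,r}(H^p,H^\infty)\le b\Big(\frac{n}{1-r}\Big)^{1/p},$$ and, for every $\lambda$ with $|\lambda|=r$, $$c(\sigma_{n,\lambda},H^p,H^\infty)\ge a\Big(\frac{n}{1-r}\Big)^{1/p}.$$ (2) For every $p\in[1,\infty)$ and $\beta>-1$ there are constants $a,b>0$ depending only on $p$ and $\beta$ such that, for all $n\ge1$, $r\in[0,1)$, $$a\Big(\frac{n}{1-r}\Big)^{(2+\beta)/p}\le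 C_{n,r}(A^p(\beta),H^\infty)\le b\Big(\frac{n}{1-r}\Big)^{(2+\beta)/p},$$ for every $\lambda$ with $|\lambda|=r$, $$c(\sigma_{n,\lambda},A^p(\beta),H^\infty)\ge a\Big(\frac{n}{1-r}\Big)^{(2+\beta)/p},$$ and $$a\,\varphi_{A^p(\beta)}\Big(1-\frac{1-r}{n}\Big)\le C_{n,r}(A^p(\beta),H^\infty)\le b\,\varphi_{A^p(\beta)}\Big(1-\frac{1-r}{n}\Big).$$ -/

import Mathlib

open scoped ENNReal

noncomputable section

namespace DiscInterp

/-- The open unit disc in the complex plane. -/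
abbrev disc : Set ℂ := Metric.ball 0 1

/-- The integral mean `M_p(ρ, f)` of `|f|` over the circle of radius `ρ`, for the normalized
arc length. -/
def circleMean (p : ℝ) (f : ℂ → ℂ) (ρ : ℝ) : ℝ≥0∞ :=
  ((ENNReal.ofReal (2 * Real.pi))⁻¹ *
    ∫⁻ θ in Set.Ioc (0 : ℝ) (2 * Real.pi), ‖f (circleMap 0 ρ θ)‖ₑ ^ p) ^ (1 / p)

/-- The norm of the Hardy space `H^p`, with values in `[0, ∞]`. -/
def hardyNorm (p : ℝ) (f : ℂ → ℂ) : ℝ≥0∞ :=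
  ⨆ ρ ∈ Set.Ico (0 : ℝ) 1, circleMean p f ρ

/-- The norm of the weighted Bergman space `A^p(β)`, with values in `[0, ∞]`; the area measure on
the disc is normalized to have total mass one. -/
def bergmanNorm (p β : ℝ) (f : ℂ → ℂ) : ℝ≥0∞ :=
  ((ENNReal.ofReal Real.pi)⁻¹ *
    ∫⁻ z in disc, ‖f z‖ₑ ^ p * ENNReal.ofReal ((1 - ‖z‖ ^ 2) ^ β)) ^ (1 / p)

/-- The supremum norm over the disc, with values in `[0, ∞]`. -/
def supNorm (f : ℂ → ℂ) : ℝ≥0∞ := ⨆ z ∈ disc, ‖f z‖ₑ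

/-- The space `H^∞` of bounded holomorphic functions on the disc. -/
def hInfty : Set (ℂ → ℂ) := {g | DifferentiableOn ℂ g disc ∧ supNorm g < ⊤}

/-- For an extended norm `N`, the closed unit ball of the space of the functions that are
holomorphic on the disc and have finite `N`-norm. -/
def unitBall (N : (ℂ → ℂ) → ℝ≥0∞) : Set (ℂ → ℂ) :=
  {f | DifferentiableOn ℂ f disc ∧ N f ≤ 1}

/-- `f` and `g` have the same trace on the finite sequence `σ`: at every point, `f - g` vanishes
at least to the order with which this point occurs in `σ`. -/
def SameTrace {n : ℕ} (σ : Fin n → ℂ) (f g : ℂ → ℂ) : Prop :=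
  ∀ z : ℂ, ((Finset.univ.filter fun i => σ i = z).card : ℕ∞) ≤
    analyticOrderAt (fun w => f w - g w) z

/-- The interpolation quantity `c(σ, X, H^∞)`, where `X` is given by its extended norm `N`. -/
def interpConst (N : (ℂ → ℂ) → ℝ≥0∞) {n : ℕ} (σ : Fin n → ℂ) : ℝ≥0∞ :=
  ⨆ f ∈ unitBall N, ⨅ g ∈ {g | g ∈ hInfty ∧ SameTrace σ f g}, supNorm g

/-- The worst-case constant `C_{n,r}(X, H^∞)`. -/
def worstInterpConst (N : (ℂ → ℂ) → ℝ≥0∞) (n : ℕ) (r : ℝ) : ℝ≥0∞ :=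
  ⨆ σ ∈ {σ : Fin n → ℂ | ∀ i, σ i ∈ disc ∧ ‖σ i‖ ≤ r}, interpConst N σ

/-- The norm of the evaluation functional `f ↦ f t` on the space with extended norm `N`. -/
def evalNorm (N : (ℂ → ℂ) → ℝ≥0∞) (t : ℂ) : ℝ≥0∞ := ⨆ f ∈ unitBall N, ‖f t‖ₑ

end DiscInterp

end

/-
Upper bound. Split `f = T + B h` with `B` the Blaschke product of `σ` and `T` in the model space,
so that `z T(z) = B(z) * conj (S (1 / conj z))` for a holomorphic `S`. Replacing `h(z)` by
`ρ² h(ρ² z)` keeps the trace on `σ` and yields a function `g` whose modulus on the unit circle is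
that of the harmonic function `conj (S (v / ρ²)) + v h(v)` at `v = ρ² z`. By the maximum principle
it is at most the supremum of `ρ |f / B|` over the circle of radius `ρ`. For
`1 - ρ = (1 - r) / (8 n)` one has `|B| ≥ 1 / 2` there, and the growth of `f` on that circle gives
the bound.

Lower bound. Test with a power of the Cauchy kernel peaked on the radius through `λ`, normalized in
`X`, at the point `x` of this radius with `1 - |x| = (1 - r) / n`. If `g` has the same trace, the
Schwarz lemma for the zero of order `n` of `f - g` at `λ`, together with the smallness of the
`n`-th power of the Blaschke factor at `x`, bounds `‖g‖_∞` below by a multiple of `|f(x)|`.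
-/

noncomputable section

namespace DiscInterp

open ComplexConjugate MeasureTheory

/-- The Möbius automorphism of the disc with zero `a`; `blaschkeFactor (-a)` is its inverse. -/
def blaschkeFactor (a z : ℂ) : ℂ := (z - a) / (1 - conj a * z)

/-- The finite Blaschke product with zeros `σ`, repeated according to multiplicity. -/
def blaschke {n : ℕ} (σ : Fin n → ℂ) (z : ℂ) : ℂ := ∏ i, blaschkeFactor (σ i) z

section Blaschke

variable {a z : ℂ} {n : ℕ} {σ : Fin n → ℂ}

theorem one_sub_mul_le_norm_one_sub_conj_mul (a z : ℂ) : 1 - ‖a‖ * ‖z‖ ≤ ‖1 - conj a * z‖ := by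
  simpa using norm_sub_norm_le 1 (conj a * z)

theorem one_sub_norm_le_norm_one_sub_conj_mul (a : ℂ) (hz : ‖z‖ ≤ 1) :
    1 - ‖a‖ ≤ ‖1 - conj a * z‖ := by
  refine le_trans ?_ (one_sub_mul_le_norm_one_sub_conj_mul a z)
  nlinarith [norm_nonneg a]

theorem one_sub_conj_mul_ne_zero_of_mul_lt_one (h : ‖a‖ * ‖z‖ < 1) : 1 - conj a * z ≠ 0 :=
  norm_pos_iff.mp ((sub_pos.mpr h).trans_le (one_sub_mul_le_norm_one_sub_conj_mul a z))

theorem one_sub_conj_mul_ne_zero (ha : ‖a‖ < 1) (hz : ‖z‖ ≤ 1) : 1 - conj a * z ≠ 0 :=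
  one_sub_conj_mul_ne_zero_of_mul_lt_one (mul_lt_one_of_nonneg_of_lt_one_left (norm_nonneg a) ha hz)

theorem one_sub_norm_blaschkeFactor_sq (h : 1 - conj a * z ≠ 0) :
    1 - ‖blaschkeFactor a z‖ ^ 2 = (1 - ‖a‖ ^ 2) * (1 - ‖z‖ ^ 2) / ‖1 - conj a * z‖ ^ 2 := by
  have key : ‖1 - conj a * z‖ ^ 2 - ‖z - a‖ ^ 2 = (1 - ‖a‖ ^ 2) * (1 - ‖z‖ ^ 2) := by
    simp only [← Complex.normSq_eq_norm_sq, Complex.normSq_apply, Complex.sub_re, Complex.sub_im,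
      Complex.mul_re, Complex.mul_im, Complex.conj_re, Complex.conj_im, Complex.one_re,
      Complex.one_im]
    ring
  have hsq : ‖1 - conj a * z‖ ^ 2 ≠ 0 := pow_ne_zero 2 (norm_ne_zero_iff.mpr h)
  rw [blaschkeFactor, norm_div, div_pow, ← key, sub_div, div_self hsq]

theorem norm_blaschkeFactor_eq_one (ha : ‖a‖ < 1) (hz : ‖z‖ = 1) : ‖blaschkeFactor a z‖ = 1 := by
  have h := one_sub_norm_blaschkeFactor_sq (one_sub_conj_mul_ne_zero ha hz.le)
  rw [hz, one_pow, sub_self, mul_zero, zero_div, sub_eq_zero] at h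
  exact (pow_eq_one_iff_of_nonneg (norm_nonneg _) two_ne_zero).mp h.symm

theorem norm_blaschkeFactor_lt_one (ha : ‖a‖ < 1) (hz : ‖z‖ < 1) : ‖blaschkeFactor a z‖ < 1 := by
  have hne := one_sub_conj_mul_ne_zero ha hz.le
  have h : 0 < 1 - ‖blaschkeFactor a z‖ ^ 2 := by
    rw [one_sub_norm_blaschkeFactor_sq hne]
    have ha2 : 0 < 1 - ‖a‖ ^ 2 := sub_pos.mpr (pow_lt_one₀ (norm_nonneg a) ha two_ne_zero)
    have hz2 : 0 < 1 - ‖z‖ ^ 2 := sub_pos.mpr (pow_lt_one₀ (norm_nonneg z) hz two_ne_zero)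
    positivity
  exact (pow_lt_one_iff_of_nonneg (norm_nonneg _) two_ne_zero).mp (sub_pos.mp h)

theorem one_sub_norm_blaschkeFactor_le (ha : ‖a‖ < 1) (hz : ‖z‖ < 1) :
    1 - ‖blaschkeFactor a z‖ ≤ 4 * (1 - ‖z‖) / (1 - ‖a‖) := by
  have ha' : 0 < 1 - ‖a‖ := sub_pos.mpr ha
  have hz' : 0 < 1 - ‖z‖ := sub_pos.mpr hz
  calc 1 - ‖blaschkeFactor a z‖ ≤ 1 - ‖blaschkeFactor a z‖ ^ 2 := by
        nlinarith [norm_nonneg (blaschkeFactor a z), norm_blaschkeFactor_lt_one ha hz]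
    _ = (1 - ‖a‖) * (1 - ‖z‖) * ((1 + ‖a‖) * (1 + ‖z‖)) / ‖1 - conj a * z‖ ^ 2 := by
        rw [one_sub_norm_blaschkeFactor_sq (one_sub_conj_mul_ne_zero ha hz.le)]
        ring
    _ ≤ (1 - ‖a‖) * (1 - ‖z‖) * (2 * 2) / (1 - ‖a‖) ^ 2 := by
        gcongr
        · linarith
        · linarith
        · exact one_sub_norm_le_norm_one_sub_conj_mul a hz.le
    _ = 4 * (1 - ‖z‖) / (1 - ‖a‖) := by field_simp; ring

theorem differentiableAt_blaschkeFactor (h : 1 - conj a * z ≠ 0) :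
    DifferentiableAt ℂ (blaschkeFactor a) z := by
  unfold blaschkeFactor
  fun_prop (disch := assumption)

theorem analyticAt_blaschkeFactor (h : 1 - conj a * z ≠ 0) :
    AnalyticAt ℂ (blaschkeFactor a) z := by
  unfold blaschkeFactor
  fun_prop (disch := assumption)

theorem blaschkeFactor_neg_blaschkeFactor (ha : ‖a‖ < 1) (hz : ‖z‖ < 1) :
    blaschkeFactor (-a) (blaschkeFactor a z) = z := by
  have h : 1 - conj a * z ≠ 0 := one_sub_conj_mul_ne_zero ha hz.le
  have ha' : 1 - conj a * a ≠ 0 := one_sub_conj_mul_ne_zero ha ha.le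
  have hmul : blaschkeFactor a z * (1 - conj a * z) = z - a := div_mul_cancel₀ _ h
  have hnum : blaschkeFactor a z - -a = z * (1 - conj a * a) / (1 - conj a * z) := by
    rw [eq_div_iff h]
    linear_combination hmul
  have hden : 1 - conj (-a) * blaschkeFactor a z = (1 - conj a * a) / (1 - conj a * z) := by
    rw [eq_div_iff h, map_neg]
    linear_combination conj a * hmul
  rw [blaschkeFactor, hnum, hden, div_div_div_cancel_right₀ h, mul_div_cancel_right₀ _ ha']

theorem differentiableAt_blaschke (h : ∀ i, 1 - conj (σ i) * z ≠ 0) :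
    DifferentiableAt ℂ (blaschke σ) z :=
  DifferentiableAt.fun_finsetProd fun i _ => differentiableAt_blaschkeFactor (h i)

theorem norm_blaschke_eq_one (hσ : ∀ i, ‖σ i‖ < 1) (hz : ‖z‖ = 1) : ‖blaschke σ z‖ = 1 := by
  rw [blaschke, norm_prod]
  exact Finset.prod_eq_one fun i _ => norm_blaschkeFactor_eq_one (hσ i) hz

theorem half_le_norm_blaschke (hσ : ∀ i, ‖σ i‖ < 1) (hz : ‖z‖ < 1)
    (h : ∀ i, 8 * n * (1 - ‖z‖) ≤ 1 - ‖σ i‖) : 1 / 2 ≤ ‖blaschke σ z‖ := by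
  rcases n.eq_zero_or_pos with rfl | hn
  · norm_num [blaschke]
  have hn' : (1 : ℝ) ≤ n := by exact_mod_cast hn
  have hfactor : ∀ i, 1 - 1 / (2 * n) ≤ ‖blaschkeFactor (σ i) z‖ := fun i => by
    have hsmall : 4 * (1 - ‖z‖) / (1 - ‖σ i‖) ≤ 1 / (2 * n) := by
      rw [div_le_div_iff₀ (sub_pos.mpr (hσ i)) (by positivity)]
      linarith [h i]
    linarith [one_sub_norm_blaschkeFactor_le (hσ i) hz]
  have hle : 1 / (2 * (n : ℝ)) ≤ 1 / 2 := by gcongr; linarith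
  have hbernoulli : 1 / 2 ≤ (1 - 1 / (2 * (n : ℝ))) ^ n := by
    refine le_trans (le_of_eq ?_) (one_add_mul_le_pow (a := -(1 / (2 * (n : ℝ)))) (by linarith) n)
    field_simp
    ring
  calc 1 / 2 ≤ ∏ _i : Fin n, (1 - 1 / (2 * (n : ℝ))) := by simpa using hbernoulli
    _ ≤ ∏ i, ‖blaschkeFactor (σ i) z‖ :=
        Finset.prod_le_prod (fun _ _ => by linarith) fun i _ => hfactor i
    _ = ‖blaschke σ z‖ := by rw [blaschke, norm_prod]

end Blaschke

theorem inv_conj_eq_div_sq {v : ℂ} {ρ : ℝ} (hv : ‖v‖ = ρ) : (conj v)⁻¹ = v / (ρ : ℂ) ^ 2 := by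
  rw [Complex.inv_def, Complex.conj_conj, Complex.normSq_conj, Complex.normSq_eq_norm_sq, hv,
    div_eq_mul_inv]
  norm_cast

theorem blaschkeFactor_mul_conj_blaschkeFactor_inv_conj {a z : ℂ} (hz : z ≠ 0) (hza : z ≠ a)
    (h : 1 - conj a * z ≠ 0) :
    blaschkeFactor a z * conj (blaschkeFactor a (conj z)⁻¹) = 1 := by
  have hza' : z - a ≠ 0 := sub_ne_zero.mpr hza
  have hreflect : conj (blaschkeFactor a (conj z)⁻¹) = (1 - conj a * z) / (z - a) := by
    have hden : 1 - a * z⁻¹ ≠ 0 := by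
      rw [← div_eq_mul_inv, one_sub_div hz]
      exact div_ne_zero hza' hz
    simp only [blaschkeFactor, map_div₀, map_sub, map_mul, map_inv₀, map_one, Complex.conj_conj]
    rw [div_eq_div_iff hden hza']
    field_simp
  rw [hreflect, blaschkeFactor, div_mul_div_cancel₀ h, div_self hza']

theorem blaschkeFactor_mul_conj_inv_one_sub {a z : ℂ} (hz : z ≠ 0) (hza : z ≠ a) :
    blaschkeFactor a z * conj (1 - conj a * (conj z)⁻¹)⁻¹ = z / (1 - conj a * z) := by
  have hza' : z - a ≠ 0 := sub_ne_zero.mpr hza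
  have hreflect : conj (1 - conj a * (conj z)⁻¹)⁻¹ = z / (z - a) := by
    simp only [map_inv₀, map_sub, map_one, map_mul, Complex.conj_conj]
    rw [← div_eq_mul_inv, one_sub_div hz, inv_div]
  rw [hreflect, blaschkeFactor, div_mul_div_comm, mul_comm, mul_div_mul_right _ _ hza']

/-- The Takenaka–Malmquist decomposition `f = modelPart + B * quotient` with respect to the
Blaschke product `B` of `σ`. The function `reflection` records that `modelPart` lies in the model
space of `B`: up to a conjugation it is the analytic continuation of `z * modelPart z / B z` across
the unit circle. -/
structure BlaschkeSplitting {n : ℕ} (σ : Fin n → ℂ) (f : ℂ → ℂ) where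
  modelPart : ℂ → ℂ
  reflection : ℂ → ℂ
  quotient : ℂ → ℂ
  differentiableAt_modelPart : ∀ z, (∀ i, 1 - conj (σ i) * z ≠ 0) →
    DifferentiableAt ℂ modelPart z
  differentiableAt_reflection : ∀ z, (∀ i, 1 - conj (σ i) * z ≠ 0) →
    DifferentiableAt ℂ reflection z
  differentiableOn_quotient : DifferentiableOn ℂ quotient disc
  eq_add : ∀ z ∈ disc, f z = modelPart z + blaschke σ z * quotient z
  mul_modelPart : ∀ z ≠ 0, (∀ i, z ≠ σ i) → (∀ i, 1 - conj (σ i) * z ≠ 0) →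
    z * modelPart z = blaschke σ z * conj (reflection (conj z)⁻¹)

namespace BlaschkeSplitting

variable {n : ℕ} {f : ℂ → ℂ}

/-- Splitting off one more zero: the value of `quotient z * (1 - conj a * z)` at the last zero `a`
is moved to the model part. -/
def succ {σ : Fin (n + 1) → ℂ} (hlast : ‖σ (Fin.last n)‖ < 1)
    (D : BlaschkeSplitting (fun i : Fin n => σ i.castSucc) f) : BlaschkeSplitting σ f :=
  let a := σ (Fin.last n)
  let B := blaschke fun i : Fin n => σ i.castSucc
  let k : ℂ → ℂ := fun z => D.quotient z * (1 - conj a * z)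
  have hk : DifferentiableOn ℂ k disc := by
    have := D.differentiableOn_quotient
    fun_prop
  have hB : ∀ z, blaschke σ z = B z * blaschkeFactor a z := fun z => Fin.prod_univ_castSucc _
  { modelPart := fun z => D.modelPart z + B z * (k a * (1 - conj a * z)⁻¹)
    reflection := fun w => blaschkeFactor a w * D.reflection w + conj (k a) * (1 - conj a * w)⁻¹
    quotient := dslope k a
    differentiableAt_modelPart := fun z hz => by
      have := hz (Fin.last n)
      have := D.differentiableAt_modelPart z fun i => hz _
      have : DifferentiableAt ℂ B z := differentiableAt_blaschke fun i => hz _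
      fun_prop (disch := assumption)
    differentiableAt_reflection := fun z hz => by
      have := hz (Fin.last n)
      have := D.differentiableAt_reflection z fun i => hz _
      have : DifferentiableAt ℂ (blaschkeFactor a) z := differentiableAt_blaschkeFactor (hz _)
      fun_prop (disch := assumption)
    differentiableOn_quotient :=
      (Complex.differentiableOn_dslope
        (Metric.isOpen_ball.mem_nhds (mem_ball_zero_iff.mpr hlast))).mpr hk
    eq_add := fun z hz => by
      have hne : 1 - conj a * z ≠ 0 := one_sub_conj_mul_ne_zero hlast (mem_ball_zero_iff.mp hz).le
      have hslope : (z - a) * dslope k a z = k z - k a := sub_smul_dslope k a z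
      have hquot : D.quotient z = k z * (1 - conj a * z)⁻¹ := (mul_inv_cancel_right₀ hne _).symm
      rw [D.eq_add z hz, hB, blaschkeFactor, hquot]
      linear_combination -(B z * (1 - conj a * z)⁻¹) * hslope
    mul_modelPart := fun z hz hzσ hne => by
      have hfactor : blaschkeFactor a z * conj (blaschkeFactor a (conj z)⁻¹) = 1 :=
        blaschkeFactor_mul_conj_blaschkeFactor_inv_conj hz (hzσ _) (hne _)
      have hkernel : blaschkeFactor a z * conj (1 - conj a * (conj z)⁻¹)⁻¹ = z / (1 - conj a * z) :=
        blaschkeFactor_mul_conj_inv_one_sub hz (hzσ _)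
      have hD := D.mul_modelPart z hz (fun i => hzσ _) fun i => hne _
      rw [hB, map_add, map_mul, map_mul, Complex.conj_conj]
      linear_combination hD - B z * conj (D.reflection (conj z)⁻¹) * hfactor - B z * k a * hkernel }

theorem nonempty_of_norm_lt_one (hf : DifferentiableOn ℂ f disc) (σ : Fin n → ℂ)
    (hσ : ∀ i, ‖σ i‖ < 1) : Nonempty (BlaschkeSplitting σ f) := by
  induction n with
  | zero =>
    exact ⟨{
      modelPart := 0
      reflection := 0
      quotient := f
      differentiableAt_modelPart := by simp
      differentiableAt_reflection := by simp
      differentiableOn_quotient := hf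
      eq_add := by simp [blaschke]
      mul_modelPart := by simp }⟩
  | succ n ih =>
    obtain ⟨D⟩ := ih (fun i => σ i.castSucc) fun i => hσ _
    exact ⟨D.succ (hσ _)⟩

end BlaschkeSplitting

theorem norm_conj_add_le_of_forall_mem_frontier {U : Set ℂ} (hU : Bornology.IsBounded U)
    {F G : ℂ → ℂ} (hF : DiffContOnCl ℂ F U) (hG : DiffContOnCl ℂ G U) {M : ℝ}
    (hM : ∀ w ∈ frontier U, ‖conj (F w) + G w‖ ≤ M) {v : ℂ} (hv : v ∈ closure U) :
    ‖conj (F v) + G v‖ ≤ M := by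
  obtain ⟨u, hu, huv⟩ := RCLike.exists_norm_eq_mul_self (conj (F v) + G v)
  -- `exp E` is holomorphic with modulus `exp (re (u * (conj F + G)))`.
  let E : ℂ → ℂ := fun w => conj u * F w + u * G w
  have hre : ∀ w, (E w).re = (u * (conj (F w) + G w)).re := fun w => by
    simp only [E, Complex.add_re, Complex.mul_re, Complex.conj_re, Complex.conj_im,
      Complex.add_im]
    ring
  have hE : DiffContOnCl ℂ (fun w => Complex.exp (E w)) U :=
    Complex.differentiable_exp.comp_diffContOnCl ((hF.const_smul (conj u)).add (hG.const_smul u))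
  have hfrontier : ∀ w ∈ frontier U, ‖Complex.exp (E w)‖ ≤ Real.exp M := fun w hw => by
    rw [Complex.norm_exp, hre, Real.exp_le_exp]
    refine (Complex.re_le_norm _).trans ?_
    rw [norm_mul, hu, one_mul]
    exact hM w hw
  have hexp := Complex.norm_le_of_forall_mem_frontier_norm_le hU hE hfrontier hv
  rw [Complex.norm_exp, hre, ← huv, Real.exp_le_exp] at hexp
  exact_mod_cast hexp

theorem differentiableAt_of_norm_lt_one {f : ℂ → ℂ} (hf : DifferentiableOn ℂ f disc) {z : ℂ}
    (hz : ‖z‖ < 1) : DifferentiableAt ℂ f z :=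
  hf.differentiableAt (Metric.isOpen_ball.mem_nhds (mem_ball_zero_iff.mpr hz))

theorem norm_sq_mul_lt {ρ : ℝ} (hρ0 : 0 < ρ) (hρ1 : ρ < 1) {z : ℂ} (hz : ‖z‖ ≤ 1) :
    ‖(ρ : ℂ) ^ 2 * z‖ < ρ := by
  rw [norm_mul, norm_pow, Complex.norm_real, Real.norm_of_nonneg hρ0.le]
  nlinarith [norm_nonneg z]

namespace BlaschkeSplitting

variable {n : ℕ} {σ : Fin n → ℂ} {f : ℂ → ℂ} (D : BlaschkeSplitting σ f) {ρ : ℝ}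

theorem mul_eq {z : ℂ} (hz : z ∈ disc) (hz0 : z ≠ 0) (hzσ : ∀ i, z ≠ σ i)
    (hne : ∀ i, 1 - conj (σ i) * z ≠ 0) :
    z * f z = blaschke σ z * (conj (D.reflection (conj z)⁻¹) + z * D.quotient z) := by
  rw [D.eq_add z hz, mul_add, D.mul_modelPart z hz0 hzσ hne]
  ring

theorem norm_conj_reflection_add_le (hρ0 : 0 < ρ) (hρ1 : ρ < 1) (hσ : ∀ i, ‖σ i‖ < ρ) {M : ℝ}
    (hM : ∀ w, ‖w‖ = ρ → ‖f w‖ ≤ M * ‖blaschke σ w‖) {v : ℂ} (hv : ‖v‖ ≤ ρ) :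
    ‖conj (D.reflection (v / (ρ : ℂ) ^ 2)) + v * D.quotient v‖ ≤ ρ * M := by
  have hreflection : DiffContOnCl ℂ (fun w => D.reflection (w / (ρ : ℂ) ^ 2))
      (Metric.ball 0 ρ) := by
    refine DifferentiableOn.diffContOnCl fun w hw => ?_
    rw [closure_ball _ hρ0.ne', mem_closedBall_zero_iff] at hw
    refine ((D.differentiableAt_reflection _ fun i => ?_).comp w
      (by fun_prop)).differentiableWithinAt
    apply one_sub_conj_mul_ne_zero_of_mul_lt_one
    rw [norm_div, norm_pow, Complex.norm_real, Real.norm_of_nonneg hρ0.le, ← mul_div_assoc,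
      div_lt_one (by positivity), sq]
    exact mul_lt_mul_of_lt_of_le_of_nonneg_of_pos (hσ i) hw (norm_nonneg _) hρ0
  have hquotient : DiffContOnCl ℂ (fun w => w * D.quotient w) (Metric.ball 0 ρ) := by
    refine DifferentiableOn.diffContOnCl fun w hw => ?_
    rw [closure_ball _ hρ0.ne', mem_closedBall_zero_iff] at hw
    exact (differentiableAt_id.mul (differentiableAt_of_norm_lt_one D.differentiableOn_quotient
      (hw.trans_lt hρ1))).differentiableWithinAt
  refine norm_conj_add_le_of_forall_mem_frontier Metric.isBounded_ball hreflection hquotient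
    (fun w hw => ?_) (by rwa [closure_ball _ hρ0.ne', mem_closedBall_zero_iff])
  rw [frontier_ball _ hρ0.ne', mem_sphere_zero_iff_norm] at hw
  have hzσ : ∀ i, w ≠ σ i := fun i h => (hσ i).ne (h ▸ hw)
  have hne : ∀ i, 1 - conj (σ i) * w ≠ 0 := fun i =>
    one_sub_conj_mul_ne_zero ((hσ i).trans hρ1) (hw.trans_lt hρ1).le
  have heq := congrArg norm (D.mul_eq (mem_ball_zero_iff.mpr (hw.trans_lt hρ1))
    (norm_pos_iff.mp (hw ▸ hρ0)) hzσ hne)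
  rw [inv_conj_eq_div_sq hw, norm_mul, norm_mul, hw] at heq
  have hB : 0 < ‖blaschke σ w‖ := norm_pos_iff.mpr <| Finset.prod_ne_zero_iff.mpr fun i _ =>
    div_ne_zero (sub_ne_zero.mpr (hzσ i)) (hne i)
  refine le_of_mul_le_mul_left ?_ hB
  calc _ = ρ * ‖f w‖ := heq.symm
    _ ≤ ρ * (M * ‖blaschke σ w‖) := by gcongr; exact hM w hw
    _ = _ := by ring

/-- Dilating `quotient` by `ρ ^ 2` keeps the trace on `σ`; on the unit circle the modulus becomes
that of the harmonic function `v ↦ conj (reflection (v / ρ ^ 2)) + v * quotient v` at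
`v = ρ ^ 2 * z`. -/
def interpolant (ρ : ℝ) (z : ℂ) : ℂ :=
  D.modelPart z + (ρ : ℂ) ^ 2 * blaschke σ z * D.quotient ((ρ : ℂ) ^ 2 * z)

theorem differentiableAt_quotient_comp (hρ0 : 0 < ρ) (hρ1 : ρ < 1) {z : ℂ} (hz : ‖z‖ ≤ 1) :
    DifferentiableAt ℂ (fun z => D.quotient ((ρ : ℂ) ^ 2 * z)) z :=
  (differentiableAt_of_norm_lt_one D.differentiableOn_quotient
    ((norm_sq_mul_lt hρ0 hρ1 hz).trans hρ1)).comp z (by fun_prop)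

theorem differentiableAt_interpolant (hρ0 : 0 < ρ) (hρ1 : ρ < 1) (hσ : ∀ i, ‖σ i‖ < 1) {z : ℂ}
    (hz : ‖z‖ ≤ 1) : DifferentiableAt ℂ (D.interpolant ρ) z := by
  have hne : ∀ i, 1 - conj (σ i) * z ≠ 0 := fun i => one_sub_conj_mul_ne_zero (hσ i) hz
  exact (D.differentiableAt_modelPart z hne).add
    (((differentiableAt_blaschke hne).const_mul _).mul
      (D.differentiableAt_quotient_comp hρ0 hρ1 hz))

theorem norm_interpolant_le_of_norm_eq_one (hρ0 : 0 < ρ) (hρ1 : ρ < 1) (hσ : ∀ i, ‖σ i‖ < ρ)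
    {M : ℝ} (hM : ∀ w, ‖w‖ = ρ → ‖f w‖ ≤ M * ‖blaschke σ w‖) {z : ℂ} (hz : ‖z‖ = 1) :
    ‖D.interpolant ρ z‖ ≤ ρ * M := by
  have hσ1 : ∀ i, ‖σ i‖ < 1 := fun i => (hσ i).trans hρ1
  have hρ : (ρ : ℂ) ≠ 0 := by exact_mod_cast hρ0.ne'
  have hmodel := D.mul_modelPart z (norm_pos_iff.mp (hz ▸ one_pos))
    (fun i h => (hσ1 i).ne (h ▸ hz)) fun i => one_sub_conj_mul_ne_zero (hσ1 i) hz.le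
  rw [inv_conj_eq_div_sq hz, Complex.ofReal_one, one_pow, div_one] at hmodel
  have hmul : z * D.interpolant ρ z = blaschke σ z *
      (conj (D.reflection z) + (ρ : ℂ) ^ 2 * z * D.quotient ((ρ : ℂ) ^ 2 * z)) := by
    rw [interpolant, mul_add, hmodel]
    ring
  have hnorm := congrArg norm hmul
  rw [norm_mul, norm_mul, hz, norm_blaschke_eq_one hσ1 hz, one_mul, one_mul] at hnorm
  have hharmonic := D.norm_conj_reflection_add_le hρ0 hρ1 hσ hM (norm_sq_mul_lt hρ0 hρ1 hz.le).le
  rw [mul_div_cancel_left₀ _ (pow_ne_zero 2 hρ)] at hharmonic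
  exact hnorm.trans_le hharmonic

theorem norm_interpolant_le (hρ0 : 0 < ρ) (hρ1 : ρ < 1) (hσ : ∀ i, ‖σ i‖ < ρ)
    {M : ℝ} (hM : ∀ w, ‖w‖ = ρ → ‖f w‖ ≤ M * ‖blaschke σ w‖) {z : ℂ} (hz : z ∈ disc) :
    ‖D.interpolant ρ z‖ ≤ ρ * M := by
  refine Complex.norm_le_of_forall_mem_frontier_norm_le Metric.isBounded_ball
    (DifferentiableOn.diffContOnCl fun w hw => ?_) (fun w hw => ?_) (subset_closure hz)
  · rw [closure_ball _ one_ne_zero, mem_closedBall_zero_iff] at hw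
    exact (D.differentiableAt_interpolant hρ0 hρ1 (fun i => (hσ i).trans hρ1)
      hw).differentiableWithinAt
  · rw [frontier_ball _ one_ne_zero, mem_sphere_zero_iff_norm] at hw
    exact D.norm_interpolant_le_of_norm_eq_one hρ0 hρ1 hσ hM hw

theorem sub_interpolant (ρ : ℝ) {z : ℂ} (hz : z ∈ disc) :
    f z - D.interpolant ρ z =
      blaschke σ z * (D.quotient z - (ρ : ℂ) ^ 2 * D.quotient ((ρ : ℂ) ^ 2 * z)) := by
  rw [D.eq_add z hz, interpolant]
  ring

end BlaschkeSplitting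

theorem card_filter_eq_zero_le_analyticOrderAt_prod {𝕜 ι : Type*} [NontriviallyNormedField 𝕜]
    {F : ι → 𝕜 → 𝕜} {z : 𝕜} (s : Finset ι) (hF : ∀ i ∈ s, AnalyticAt 𝕜 (F i) z) [DecidableEq 𝕜] :
    ((s.filter fun i => F i z = 0).card : ℕ∞) ≤ analyticOrderAt (∏ i ∈ s, F i) z := by
  classical
  induction s using Finset.induction_on with
  | empty => simp
  | insert i s hi ih =>
    have hs : ∀ j ∈ s, AnalyticAt 𝕜 (F j) z := fun j hj => hF j (Finset.mem_insert_of_mem hj)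
    have hFi : AnalyticAt 𝕜 (F i) z := hF i (Finset.mem_insert_self i s)
    rw [Finset.prod_insert hi, analyticOrderAt_mul hFi (Finset.analyticAt_prod s hs),
      Finset.filter_insert]
    split_ifs with hzero
    · rw [Finset.card_insert_of_notMem fun h => hi (Finset.mem_filter.mp h).1, Nat.cast_add,
        Nat.cast_one, add_comm]
      exact add_le_add
        (Order.one_le_iff_ne_zero.mpr (hFi.analyticOrderAt_ne_zero.mpr hzero)) (ih hs)
    · exact (ih hs).trans le_add_self

theorem sameTrace_of_sub_eq_blaschke_mul {n : ℕ} {σ : Fin n → ℂ} (hσ : ∀ i, ‖σ i‖ < 1)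
    {f g k : ℂ → ℂ} (hk : DifferentiableOn ℂ k disc)
    (h : ∀ z ∈ disc, f z - g z = blaschke σ z * k z) : SameTrace σ f g := by
  classical
  intro z
  by_cases hz : ‖z‖ < 1
  · have hnhds : disc ∈ nhds z := Metric.isOpen_ball.mem_nhds (mem_ball_zero_iff.mpr hz)
    have hfactor : ∀ i, AnalyticAt ℂ (blaschkeFactor (σ i)) z := fun i =>
      analyticAt_blaschkeFactor (one_sub_conj_mul_ne_zero (hσ i) hz.le)
    have hprod : blaschke σ = ∏ i, blaschkeFactor (σ i) := by
      ext w
      rw [blaschke, Finset.prod_apply]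
    calc _ ≤ ((Finset.univ.filter fun i => blaschkeFactor (σ i) z = 0).card : ℕ∞) := by
          refine Nat.cast_le.mpr (Finset.card_le_card (Finset.monotone_filter_right _ ?_))
          rintro i - rfl
          rw [blaschkeFactor, sub_self, zero_div]
      _ ≤ analyticOrderAt (blaschke σ) z :=
          hprod ▸ card_filter_eq_zero_le_analyticOrderAt_prod _ fun i _ => hfactor i
      _ ≤ analyticOrderAt (blaschke σ * k) z := by
          rw [analyticOrderAt_mul (hprod ▸ Finset.analyticAt_prod _ fun i _ => hfactor i)
            (hk.analyticAt hnhds)]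
          exact le_self_add
      _ = analyticOrderAt (fun w => f w - g w) z :=
          analyticOrderAt_congr (Filter.eventually_of_mem hnhds fun w hw => (h w hw).symm)
  · rw [Finset.filter_eq_empty_iff.mpr fun i _ (hi : σ i = z) => hz (hi ▸ hσ i)]
    simp

theorem supNorm_le_ofReal {g : ℂ → ℂ} {M : ℝ} (h : ∀ z ∈ disc, ‖g z‖ ≤ M) :
    supNorm g ≤ ENNReal.ofReal M :=
  iSup₂_le fun z hz => ofReal_norm (g z) ▸ ENNReal.ofReal_le_ofReal (h z hz)

theorem exists_sameTrace_supNorm_le {n : ℕ} {σ : Fin n → ℂ} {ρ M : ℝ} (hρ0 : 0 < ρ) (hρ1 : ρ < 1)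
    (hσ : ∀ i, ‖σ i‖ < ρ) {f : ℂ → ℂ} (hf : DifferentiableOn ℂ f disc)
    (hM : ∀ w, ‖w‖ = ρ → ‖f w‖ ≤ M * ‖blaschke σ w‖) :
    ∃ g ∈ hInfty, SameTrace σ f g ∧ supNorm g ≤ ENNReal.ofReal (ρ * M) := by
  have hσ1 : ∀ i, ‖σ i‖ < 1 := fun i => (hσ i).trans hρ1
  obtain ⟨D⟩ := BlaschkeSplitting.nonempty_of_norm_lt_one hf σ hσ1
  have hbound : supNorm (D.interpolant ρ) ≤ ENNReal.ofReal (ρ * M) :=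
    supNorm_le_ofReal fun z hz => D.norm_interpolant_le hρ0 hρ1 hσ hM hz
  refine ⟨D.interpolant ρ, ⟨fun z hz => ?_, hbound.trans_lt ENNReal.ofReal_lt_top⟩,
    sameTrace_of_sub_eq_blaschke_mul hσ1 (fun z hz => ?_) fun z hz => D.sub_interpolant ρ hz,
    hbound⟩
  · exact (D.differentiableAt_interpolant hρ0 hρ1 hσ1
      (mem_ball_zero_iff.mp hz).le).differentiableWithinAt
  · exact (D.differentiableOn_quotient z hz).sub (((D.differentiableAt_quotient_comp hρ0 hρ1
      (mem_ball_zero_iff.mp hz).le).const_mul _).differentiableWithinAt)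

theorem worstInterpConst_le {N : (ℂ → ℂ) → ℝ≥0∞} {s C : ℝ} (hC : 0 ≤ C)
    (hN : ∀ f ∈ unitBall N, ∀ w ∈ disc, ‖f w‖ ≤ C * (1 - ‖w‖) ^ (-s)) {n : ℕ} {r : ℝ}
    (hn : 1 ≤ n) (hr0 : 0 ≤ r) (hr1 : r < 1) :
    worstInterpConst N n r ≤ ENNReal.ofReal (2 * C * 8 ^ s * ((n : ℝ) / (1 - r)) ^ s) := by
  refine iSup₂_le fun σ hσ => iSup₂_le fun f hf => ?_
  have hn' : (1 : ℝ) ≤ n := by exact_mod_cast hn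
  have hr : 0 < 1 - r := sub_pos.mpr hr1
  set d : ℝ := (1 - r) / (8 * n) with hd
  have hd0 : 0 < d := by positivity
  have hdr : d < 1 - r := div_lt_self hr (by linarith)
  have hmul : 8 * n * d = 1 - r := mul_div_cancel₀ _ (by positivity)
  have hbound : ∀ w, ‖w‖ = 1 - d → ‖f w‖ ≤ 2 * C * d ^ (-s) * ‖blaschke σ w‖ := fun w hw => by
    have hw1 : ‖w‖ < 1 := by linarith
    have hhalf : 1 / 2 ≤ ‖blaschke σ w‖ :=
      half_le_norm_blaschke (fun i => (hσ i).2.trans_lt hr1) hw1 fun i => by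
        rw [hw, sub_sub_cancel, hmul]
        linarith [(hσ i).2]
    have hfw := hN f hf w (mem_ball_zero_iff.mpr hw1)
    rw [hw, sub_sub_cancel] at hfw
    have : 0 ≤ C * d ^ (-s) := by positivity
    nlinarith
  obtain ⟨g, hg, htrace, hgle⟩ := exists_sameTrace_supNorm_le (by linarith) (by linarith)
    (fun i => (hσ i).2.trans_lt (by linarith)) hf.1 hbound
  refine (iInf₂_le g ⟨hg, htrace⟩).trans (hgle.trans (ENNReal.ofReal_le_ofReal ?_))
  calc (1 - d) * (2 * C * d ^ (-s)) ≤ 2 * C * d ^ (-s) :=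
        mul_le_of_le_one_left (by positivity) (by linarith)
    _ = 2 * C * (8 * (n / (1 - r))) ^ s := by
        rw [Real.rpow_neg hd0.le, ← Real.inv_rpow hd0.le, hd, inv_div, mul_div_assoc]
    _ = 2 * C * 8 ^ s * (n / (1 - r)) ^ s := by
        rw [Real.mul_rpow (by norm_num) (by positivity), mul_assoc (2 * C)]

section Schwarz

variable {E : Type*} [NormedAddCommGroup E] [NormedSpace ℂ E] [CompleteSpace E] {h : ℂ → E} {K : ℝ}
  {n : ℕ} {z : ℂ}

theorem norm_le_mul_norm_pow_of_le_analyticOrderAt (hd : DifferentiableOn ℂ h disc)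
    (hK : ∀ w ∈ disc, ‖h w‖ ≤ K) (hord : (n : ℕ∞) ≤ analyticOrderAt h 0) (hz : z ∈ disc) :
    ‖h z‖ ≤ K * ‖z‖ ^ n := by
  obtain _ | m := n
  · simpa using hK z hz
  have h0 : h 0 = 0 := apply_eq_zero_of_analyticOrderAt_ne_zero (𝕜 := ℂ) <|
    (lt_of_lt_of_le (by exact_mod_cast m.succ_pos) hord).ne'
  have hanalytic : AnalyticAt ℂ h 0 := hd.analyticAt (Metric.ball_mem_nhds 0 one_pos)
  obtain ⟨q, hq, hhq⟩ := (natCast_le_analyticOrderAt hanalytic).mp hord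
  have hlittle : (fun w => h w - h 0) =o[nhds 0] fun w => ‖w - 0‖ ^ m := by
    have hzero : (fun w => w • q w) =o[nhds 0] fun _ => (1 : ℝ) := by
      rw [Asymptotics.isLittleO_one_iff]
      simpa using (continuousAt_id.fun_smul hq.continuousAt).tendsto
    refine ((Asymptotics.isBigO_refl (fun w : ℂ => w ^ m) _).norm_right.smul_isLittleO
      hzero).congr' ?_ ?_
    · filter_upwards [hhq] with w hw
      rw [hw, h0, sub_zero, sub_zero, pow_succ, mul_smul]
    · exact .of_forall fun w => by simp
  have hmaps : Set.MapsTo h disc (Metric.closedBall (h 0) K) := fun w hw => by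
    simpa [h0] using hK w hw
  simpa [h0] using Complex.dist_le_mul_div_pow_of_mapsTo_ball_of_isLittleO hd hmaps hlittle hz

theorem norm_le_mul_norm_blaschkeFactor_pow (hd : DifferentiableOn ℂ h disc)
    (hK : ∀ w ∈ disc, ‖h w‖ ≤ K) {a : ℂ} (ha : ‖a‖ < 1) (hord : (n : ℕ∞) ≤ analyticOrderAt h a)
    (hz : z ∈ disc) : ‖h z‖ ≤ K * ‖blaschkeFactor a z‖ ^ n := by
  set b := blaschkeFactor (-a) with hb
  have ha' : ‖-a‖ < 1 := by rwa [norm_neg]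
  have hne : ∀ w ∈ disc, 1 - conj (-a) * w ≠ 0 := fun w hw =>
    one_sub_conj_mul_ne_zero ha' (mem_ball_zero_iff.mp hw).le
  have hmaps : Set.MapsTo b disc disc := fun w hw =>
    mem_ball_zero_iff.mpr (norm_blaschkeFactor_lt_one ha' (mem_ball_zero_iff.mp hw))
  have hb0 : b 0 = a := by simp [hb, blaschkeFactor]
  have hanalytic : AnalyticAt ℂ h (b 0) := hd.analyticAt <|
    Metric.isOpen_ball.mem_nhds (by rwa [hb0, mem_ball_zero_iff])
  have hanalytic_b : AnalyticAt ℂ b 0 := analyticAt_blaschkeFactor (hne 0 (by simp))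
  have horder : (n : ℕ∞) ≤ analyticOrderAt (h ∘ b) 0 := by
    rw [hanalytic.analyticOrderAt_comp hanalytic_b, hb0]
    refine hord.trans (le_mul_of_one_le_right' (Order.one_le_iff_ne_zero.mpr ?_))
    rw [AnalyticAt.analyticOrderAt_ne_zero (by fun_prop), hb0, sub_self]
  have hschwarz := norm_le_mul_norm_pow_of_le_analyticOrderAt
    (hd.comp
      (fun w hw => (differentiableAt_blaschkeFactor (hne w hw)).differentiableWithinAt) hmaps)
    (fun w hw => hK _ (hmaps hw)) horder (z := blaschkeFactor a z)
    (mem_ball_zero_iff.mpr (norm_blaschkeFactor_lt_one ha (mem_ball_zero_iff.mp hz)))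
  rwa [Function.comp_apply, blaschkeFactor_neg_blaschkeFactor ha (mem_ball_zero_iff.mp hz)]
    at hschwarz

end Schwarz

theorem ofReal_le_interpConst_const {N : (ℂ → ℂ) → ℝ≥0∞} {f : ℂ → ℂ} (hf : f ∈ unitBall N) {M : ℝ}
    (hM : ∀ z ∈ disc, ‖f z‖ ≤ M) {a x : ℂ} (ha : ‖a‖ < 1) (hx : x ∈ disc) (n : ℕ) :
    ENNReal.ofReal ((‖f x‖ - M * ‖blaschkeFactor a x‖ ^ n) / (1 + ‖blaschkeFactor a x‖ ^ n)) ≤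
      interpConst N (fun _ : Fin n => a) := by
  refine le_trans (le_iInf₂ ?_) (le_iSup₂ (f := fun f _ => ⨅ g ∈ {g | g ∈ hInfty ∧
    SameTrace (fun _ : Fin n => a) f g}, supNorm g) f hf)
  rintro g ⟨hg, htrace⟩
  have hgle : ∀ z ∈ disc, ‖g z‖ ≤ (supNorm g).toReal := fun z hz => by
    rw [← toReal_enorm]
    exact ENNReal.toReal_mono hg.2.ne (le_iSup₂ (f := fun z (_ : z ∈ disc) => ‖g z‖ₑ) z hz)
  have hschwarz := norm_le_mul_norm_blaschkeFactor_pow (h := fun w => f w - g w)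
    (hf.1.sub hg.1)
    (fun z hz => (norm_sub_le _ _).trans (add_le_add (hM z hz) (hgle z hz))) ha
    (by simpa using htrace a) hx
  rw [ENNReal.ofReal_le_iff_le_toReal hg.2.ne, div_le_iff₀ (by positivity)]
  linarith [norm_sub_norm_le (f x) (g x), hgle x hx, hschwarz]

section Radial

variable {u : ℂ} {r t x : ℝ}

theorem norm_one_sub_conj_mul_radial (hu : ‖u‖ = 1) (h : t * x ≤ 1) :
    ‖1 - conj ((t : ℂ) * u) * (x * u)‖ = 1 - t * x := by
  have huu : conj u * u = 1 := by rw [Complex.conj_mul', hu, Complex.ofReal_one, one_pow]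
  have hreal : 1 - conj ((t : ℂ) * u) * (x * u) = ((1 - t * x : ℝ) : ℂ) := by
    rw [map_mul, Complex.conj_ofReal]
    push_cast
    linear_combination (-(t : ℂ) * x) * huu
  rw [hreal, Complex.norm_real, Real.norm_of_nonneg (sub_nonneg.mpr h)]

theorem norm_blaschkeFactor_radial (hu : ‖u‖ = 1) (h : r * x ≤ 1) :
    ‖blaschkeFactor (r * u) (x * u)‖ = |x - r| / (1 - r * x) := by
  rw [blaschkeFactor, norm_div, norm_one_sub_conj_mul_radial hu h, ← sub_mul, norm_mul, hu, mul_one,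
    ← Complex.ofReal_sub, Complex.norm_real, Real.norm_eq_abs]

theorem norm_blaschkeFactor_radial_pow_le_half (hu : ‖u‖ = 1) (hr0 : 0 ≤ r) (hr1 : r < 1) {n : ℕ}
    (hn : 1 ≤ n) :
    ‖blaschkeFactor (r * u) ((1 - (1 - r) / n : ℝ) * u)‖ ^ n ≤ 1 / 2 := by
  have hn' : (1 : ℝ) ≤ n := by exact_mod_cast hn
  have hr : 0 < 1 - r := sub_pos.mpr hr1
  set x := 1 - (1 - r) / n
  have hx1 : x ≤ 1 := sub_le_self _ (by positivity)
  have hn1 : 0 ≤ 1 - 1 / (n : ℝ) := sub_nonneg.mpr ((div_le_one (by positivity)).mpr hn')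
  have hxr : x - r = (1 - 1 / n) * (1 - r) := by ring
  have hrx : 1 - r ≤ 1 - r * x := by nlinarith
  have hfactor : ‖blaschkeFactor (r * u) (x * u)‖ ≤ 1 - 1 / n := by
    rw [norm_blaschkeFactor_radial hu (by linarith), hxr, abs_of_nonneg (by positivity),
      div_le_iff₀ (hr.trans_le hrx)]
    gcongr
  calc ‖blaschkeFactor (r * u) (x * u)‖ ^ n ≤ (1 - 1 / n) ^ n := by gcongr
    _ ≤ Real.exp (-1) := Real.one_sub_div_pow_le_exp_neg hn'
    _ ≤ 1 / 2 := by linarith [Real.exp_neg_one_lt_half]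

end Radial

/-- The `k`-th power of the Cauchy kernel at `ζ`, scaled so that its size near `ζ` is
`(1 - ‖ζ‖) ^ (-s)`. -/
def normalizedKernel (s : ℝ) (k : ℕ) (ζ w : ℂ) : ℂ :=
  ((1 - ‖ζ‖) ^ ((k : ℝ) - s) : ℝ) / (1 - conj ζ * w) ^ k

section NormalizedKernel

variable {s : ℝ} {k : ℕ} {ζ w : ℂ}

theorem differentiableOn_normalizedKernel (hζ : ‖ζ‖ < 1) :
    DifferentiableOn ℂ (normalizedKernel s k ζ) disc := fun w hw => by
  have hne := one_sub_conj_mul_ne_zero hζ (mem_ball_zero_iff.mp hw).le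
  have hpow : (1 - conj ζ * w) ^ k ≠ 0 := pow_ne_zero k hne
  unfold normalizedKernel
  fun_prop (disch := assumption)

theorem norm_normalizedKernel (hζ : ‖ζ‖ < 1) (w : ℂ) : ‖normalizedKernel s k ζ w‖ =
    (1 - ‖ζ‖) ^ (-s) * ((1 - ‖ζ‖) / ‖1 - conj ζ * w‖) ^ k := by
  have hδ : 0 < 1 - ‖ζ‖ := sub_pos.mpr hζ
  rw [normalizedKernel, norm_div, norm_pow, Complex.norm_real, Real.norm_of_nonneg (by positivity),
    sub_eq_add_neg (k : ℝ), add_comm (k : ℝ), Real.rpow_add hδ, Real.rpow_natCast, div_pow,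
    mul_div_assoc]

theorem norm_normalizedKernel_le (hζ : ‖ζ‖ < 1) (hw : ‖w‖ ≤ 1) :
    ‖normalizedKernel s k ζ w‖ ≤ (1 - ‖ζ‖) ^ (-s) := by
  have : 0 < 1 - ‖ζ‖ := sub_pos.mpr hζ
  rw [norm_normalizedKernel hζ]
  refine mul_le_of_le_one_right (by positivity) (pow_le_one₀ (by positivity) ?_)
  exact div_le_one_of_le₀ (one_sub_norm_le_norm_one_sub_conj_mul ζ hw) (norm_nonneg _)

theorem le_norm_normalizedKernel (hζ : ‖ζ‖ < 1) (hw : ‖w‖ ≤ 1) {L : ℝ}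
    (hL : ‖1 - conj ζ * w‖ ≤ L * (1 - ‖ζ‖)) :
    (1 - ‖ζ‖) ^ (-s) / L ^ k ≤ ‖normalizedKernel s k ζ w‖ := by
  have hδ : 0 < 1 - ‖ζ‖ := sub_pos.mpr hζ
  have hD : 0 < ‖1 - conj ζ * w‖ := norm_pos_iff.mpr (one_sub_conj_mul_ne_zero hζ hw)
  have hL0 : 0 < L := pos_of_mul_pos_left (hD.trans_le hL) hδ.le
  rw [norm_normalizedKernel hζ, div_eq_mul_inv, ← inv_pow]
  gcongr
  rw [inv_eq_one_div, div_le_div_iff₀ hL0 hD]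
  linarith

end NormalizedKernel

section LowerBound

theorem three_fourths_le_inv_one_add_pow (k : ℕ) :
    3 / 4 ≤ ((1 + 1 / (4 * k + 1 : ℝ)) ^ k)⁻¹ := by
  have hinv : (1 + 1 / (4 * k + 1 : ℝ))⁻¹ = 1 + -(1 / (4 * k + 2)) := by
    field_simp
    ring
  have hbernoulli : 1 + (k : ℝ) * -(1 / (4 * k + 2)) ≤ (1 + -(1 / (4 * k + 2))) ^ k := by
    refine one_add_mul_le_pow ?_ k
    rw [neg_le_neg_iff]
    exact (div_le_one_of_le₀ (by linarith) (by positivity)).trans one_le_two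
  have hfrac : (k : ℝ) * (1 / (4 * k + 2)) ≤ 1 / 4 := by
    rw [mul_one_div, div_le_div_iff₀ (by positivity) (by norm_num)]
    linarith
  rw [← inv_pow, hinv]
  linarith

theorem exists_normalizedKernel_peaked {s : ℝ} (hs : 0 ≤ s) (k : ℕ) {u : ℂ} (hu : ‖u‖ = 1) {P : ℝ}
    (hP : 1 ≤ P) : ∃ ζ ∈ disc, (4 * k + 1) ^ (-s) * P ^ s ≤ (1 - ‖ζ‖) ^ (-s) ∧
      3 / 4 * (1 - ‖ζ‖) ^ (-s) ≤ ‖normalizedKernel s k ζ ((1 - P⁻¹ : ℝ) * u)‖ := by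
  obtain ⟨t, ht⟩ : ∃ t : ℝ, t = P / (4 * k + 1 + P) := ⟨_, rfl⟩
  have hδ : 1 - t = (4 * k + 1) / (4 * k + 1 + P) := by rw [ht]; field_simp; ring
  have hδ0 : 0 < 1 - t := by rw [hδ]; positivity
  have ht0 : 0 ≤ t := by rw [ht]; positivity
  have hPinv : 0 < P⁻¹ ∧ P⁻¹ ≤ 1 := ⟨by positivity, inv_le_one_of_one_le₀ hP⟩
  have hζ : ‖(t : ℂ) * u‖ = t := by rw [norm_mul, hu, mul_one, Complex.norm_of_nonneg ht0]
  have hζ1 : ‖(t : ℂ) * u‖ < 1 := hζ.trans_lt (sub_pos.mp hδ0)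
  have hx : ‖((1 - P⁻¹ : ℝ) : ℂ) * u‖ ≤ 1 := by
    rw [norm_mul, hu, mul_one, Complex.norm_of_nonneg] <;> linarith
  have hdenom : ‖1 - conj ((t : ℂ) * u) * ((1 - P⁻¹ : ℝ) * u)‖ ≤
      (1 + 1 / (4 * k + 1 : ℝ)) * (1 - ‖(t : ℂ) * u‖) := by
    rw [norm_one_sub_conj_mul_radial hu (by nlinarith), hζ, ht]
    field_simp
    linarith
  refine ⟨t * u, mem_ball_zero_iff.mpr hζ1, ?_,
    le_trans ?_ (le_norm_normalizedKernel hζ1 hx hdenom)⟩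
  · calc (4 * k + 1) ^ (-s) * P ^ s = (P / (4 * k + 1)) ^ s := by
          rw [Real.div_rpow (by positivity) (by positivity), Real.rpow_neg (by positivity),
            div_eq_inv_mul]
      _ ≤ ((4 * k + 1 + P) / (4 * k + 1)) ^ s := by
          gcongr
          linarith
      _ = (1 - ‖(t : ℂ) * u‖) ^ (-s) := by
          rw [hζ, Real.rpow_neg hδ0.le, ← Real.inv_rpow hδ0.le, hδ, inv_div]
  · rw [hζ, div_eq_mul_inv, mul_comm]
    exact mul_le_mul_of_nonneg_left (three_fourths_le_inv_one_add_pow k)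
      (Real.rpow_nonneg hδ0.le _)

variable {N : (ℂ → ℂ) → ℝ≥0∞} {s c : ℝ} {k n : ℕ}

theorem norm_const_smul_normalizedKernel (hc : 0 ≤ c) (ζ w : ℂ) :
    ‖((c : ℂ) • normalizedKernel s k ζ) w‖ = c * ‖normalizedKernel s k ζ w‖ := by
  rw [Pi.smul_apply, norm_smul, Complex.norm_of_nonneg hc]

theorem ofReal_div_six_le_interpConst_const {f : ℂ → ℂ} (hf : f ∈ unitBall N) {M : ℝ}
    (hM : ∀ z ∈ disc, ‖f z‖ ≤ M) {a x : ℂ} (ha : ‖a‖ < 1) (hx : x ∈ disc)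
    (hfx : 3 / 4 * M ≤ ‖f x‖) (hhalf : ‖blaschkeFactor a x‖ ^ n ≤ 1 / 2) :
    ENNReal.ofReal (M / 6) ≤ interpConst N (fun _ : Fin n => a) := by
  refine le_trans (ENNReal.ofReal_le_ofReal ?_) (ofReal_le_interpConst_const hf hM ha hx n)
  have hM0 : 0 ≤ M := (norm_nonneg _).trans (hM x hx)
  rw [le_div_iff₀ (by positivity)]
  nlinarith [mul_le_mul_of_nonneg_left hhalf hM0]

theorem ofReal_mul_rpow_le_interpConst_const (hs : 0 ≤ s) (hc : 0 ≤ c)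
    (hL : ∀ ζ ∈ disc, (c : ℂ) • normalizedKernel s k ζ ∈ unitBall N) (hn : 1 ≤ n) {a : ℂ}
    (ha : ‖a‖ < 1) :
    ENNReal.ofReal (c / 6 * (4 * k + 1) ^ (-s) * (n / (1 - ‖a‖)) ^ s) ≤
      interpConst N (fun _ : Fin n => a) := by
  obtain ⟨u, hu, hau⟩ : ∃ u : ℂ, ‖u‖ = 1 ∧ ‖a‖ * u = a :=
    ⟨_, Complex.norm_exp_ofReal_mul_I _, Complex.norm_mul_exp_arg_mul_I a⟩
  have ha1 : 0 < 1 - ‖a‖ := sub_pos.mpr ha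
  set P : ℝ := n / (1 - ‖a‖) with hP
  have hP1 : 1 ≤ P := by
    rw [hP, one_le_div ha1]
    exact (sub_le_self _ (norm_nonneg a)).trans (by exact_mod_cast hn)
  have hx : ((1 - P⁻¹ : ℝ) : ℂ) * u ∈ disc := by
    have hPinv : 0 < P⁻¹ ∧ P⁻¹ ≤ 1 := ⟨by positivity, inv_le_one_of_one_le₀ hP1⟩
    rw [mem_ball_zero_iff, norm_mul, hu, mul_one, Complex.norm_of_nonneg] <;> linarith
  obtain ⟨ζ, hζ, hsize, hpeak⟩ := exists_normalizedKernel_peaked hs k hu hP1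
  have hhalf := norm_blaschkeFactor_radial_pow_le_half hu (norm_nonneg a) ha hn
  rw [hau, ← inv_div, ← hP] at hhalf
  refine le_trans (ENNReal.ofReal_le_ofReal ?_) (ofReal_div_six_le_interpConst_const (hL ζ hζ)
    (M := c * (1 - ‖ζ‖) ^ (-s)) (fun z hz => ?_) ha hx ?_ hhalf)
  · calc c / 6 * (4 * k + 1) ^ (-s) * P ^ s = c / 6 * ((4 * k + 1) ^ (-s) * P ^ s) := by ring
      _ ≤ c / 6 * (1 - ‖ζ‖) ^ (-s) := by gcongr
      _ = c * (1 - ‖ζ‖) ^ (-s) / 6 := by ring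
  · rw [norm_const_smul_normalizedKernel hc]
    exact mul_le_mul_of_nonneg_left
      (norm_normalizedKernel_le (mem_ball_zero_iff.mp hζ) (mem_ball_zero_iff.mp hz).le) hc
  · rw [norm_const_smul_normalizedKernel hc, mul_left_comm]
    exact mul_le_mul_of_nonneg_left hpeak hc

end LowerBound

section Estimates

variable {N : (ℂ → ℂ) → ℝ≥0∞} {s c C : ℝ} {k n : ℕ}

theorem evalNorm_le (hU : ∀ f ∈ unitBall N, ∀ w ∈ disc, ‖f w‖ ≤ C * (1 - ‖w‖) ^ (-s)) {ζ : ℂ}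
    (hζ : ζ ∈ disc) : evalNorm N ζ ≤ ENNReal.ofReal (C * (1 - ‖ζ‖) ^ (-s)) :=
  iSup₂_le fun f hf => by
    rw [← ofReal_norm]
    exact ENNReal.ofReal_le_ofReal (hU f hf ζ hζ)

theorem le_evalNorm (hc : 0 ≤ c)
    (hL : ∀ ζ ∈ disc, (c : ℂ) • normalizedKernel s k ζ ∈ unitBall N) {ζ : ℂ} (hζ : ζ ∈ disc) :
    ENNReal.ofReal (c / 2 ^ k * (1 - ‖ζ‖) ^ (-s)) ≤ evalNorm N ζ := by
  have hζ1 : ‖ζ‖ < 1 := mem_ball_zero_iff.mp hζ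
  refine le_trans ?_ (le_iSup₂ (f := fun (f : ℂ → ℂ) (_ : f ∈ unitBall N) => ‖f ζ‖ₑ) _ (hL ζ hζ))
  have hdiag : ‖1 - conj ζ * ζ‖ ≤ 2 * (1 - ‖ζ‖) := by
    rw [Complex.conj_mul', ← Complex.ofReal_pow, ← Complex.ofReal_one, ← Complex.ofReal_sub,
      Complex.norm_of_nonneg] <;> nlinarith [norm_nonneg ζ]
  rw [← ofReal_norm, norm_const_smul_normalizedKernel hc, div_mul_eq_mul_div, mul_div_assoc]
  exact ENNReal.ofReal_le_ofReal
    (mul_le_mul_of_nonneg_left (le_norm_normalizedKernel hζ1 hζ1.le hdiag) hc)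

theorem interpConst_le_worstInterpConst {σ : Fin n → ℂ} {r : ℝ} (hr : r < 1)
    (hσ : ∀ i, ‖σ i‖ ≤ r) : interpConst N σ ≤ worstInterpConst N n r :=
  le_iSup₂ (f := fun (σ : Fin n → ℂ) (_ : σ ∈ {σ : Fin n → ℂ | ∀ i, σ i ∈ disc ∧ ‖σ i‖ ≤ r}) =>
    interpConst N σ) σ fun i => ⟨mem_ball_zero_iff.mpr ((hσ i).trans_lt hr), hσ i⟩

theorem evalNorm_estimates (hc : 0 ≤ c)
    (hU : ∀ f ∈ unitBall N, ∀ w ∈ disc, ‖f w‖ ≤ C * (1 - ‖w‖) ^ (-s))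
    (hL : ∀ ζ ∈ disc, (c : ℂ) • normalizedKernel s k ζ ∈ unitBall N) {r : ℝ} (hn : 1 ≤ n)
    (hr0 : 0 ≤ r) (hr1 : r < 1) :
    ENNReal.ofReal (c / 2 ^ k * (n / (1 - r)) ^ s) ≤ evalNorm N ((1 - (1 - r) / n : ℝ) : ℂ) ∧
      evalNorm N ((1 - (1 - r) / n : ℝ) : ℂ) ≤ ENNReal.ofReal (C * (n / (1 - r)) ^ s) := by
  have hn' : (1 : ℝ) ≤ n := by exact_mod_cast hn
  have : 0 < 1 - r := sub_pos.mpr hr1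
  have hδ0 : 0 < (1 - r) / n := by positivity
  have hδ1 : (1 - r) / n ≤ 1 := div_le_one_of_le₀ (by linarith) (by positivity)
  have hnorm : ‖((1 - (1 - r) / n : ℝ) : ℂ)‖ = 1 - (1 - r) / n :=
    Complex.norm_of_nonneg (sub_nonneg.mpr hδ1)
  have hmem : ((1 - (1 - r) / n : ℝ) : ℂ) ∈ disc := by
    rw [mem_ball_zero_iff, hnorm]
    exact sub_lt_self 1 hδ0
  have hrpow : (1 - ‖((1 - (1 - r) / n : ℝ) : ℂ)‖) ^ (-s) = (n / (1 - r)) ^ s := by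
    rw [hnorm, sub_sub_cancel, Real.rpow_neg hδ0.le, ← Real.inv_rpow hδ0.le, inv_div]
  rw [← hrpow]
  exact ⟨le_evalNorm hc hL hmem, evalNorm_le hU hmem⟩

theorem exists_interpConst_estimates (hs : 0 ≤ s) (hc : 0 < c) (hC : 0 < C)
    (hU : ∀ f ∈ unitBall N, ∀ w ∈ disc, ‖f w‖ ≤ C * (1 - ‖w‖) ^ (-s))
    (hL : ∀ ζ ∈ disc, (c : ℂ) • normalizedKernel s k ζ ∈ unitBall N) :
    ∃ a b : ℝ, 0 < a ∧ 0 < b ∧ ∀ (n : ℕ) (r : ℝ), 1 ≤ n → 0 ≤ r → r < 1 →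
      ENNReal.ofReal (a * ((n : ℝ) / (1 - r)) ^ s) ≤ worstInterpConst N n r ∧
      worstInterpConst N n r ≤ ENNReal.ofReal (b * ((n : ℝ) / (1 - r)) ^ s) ∧
      (∀ z : ℂ, ‖z‖ = r →
        ENNReal.ofReal (a * ((n : ℝ) / (1 - r)) ^ s) ≤ interpConst N (fun _ : Fin n => z)) ∧
      ENNReal.ofReal a * evalNorm N ((1 - (1 - r) / (n : ℝ) : ℝ) : ℂ) ≤ worstInterpConst N n r ∧
      worstInterpConst N n r ≤ ENNReal.ofReal b * evalNorm N ((1 - (1 - r) / (n : ℝ) : ℝ) : ℂ) := by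
  set a₀ : ℝ := c / 6 * (4 * k + 1) ^ (-s)
  set b₀ : ℝ := 2 * C * 8 ^ s
  have : 0 < a₀ := by positivity
  have : 0 < b₀ := by positivity
  have ha : 0 < min a₀ (a₀ / C) := by positivity
  have hb : 0 < max b₀ (b₀ / (c / 2 ^ k)) := by positivity
  refine ⟨_, _, ha, hb, fun n r hn hr0 hr1 => ?_⟩
  set Q : ℝ := (n / (1 - r)) ^ s
  have hQ : 0 ≤ Q := Real.rpow_nonneg (div_nonneg n.cast_nonneg (sub_nonneg.mpr hr1.le)) s
  have hconst : ∀ z : ℂ, ‖z‖ = r → ENNReal.ofReal (a₀ * Q) ≤ interpConst N fun _ : Fin n => z := by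
    rintro z rfl
    exact ofReal_mul_rpow_le_interpConst_const hs hc.le hL hn hr1
  have hlower : ENNReal.ofReal (a₀ * Q) ≤ worstInterpConst N n r :=
    have hnorm : ‖(r : ℂ)‖ = r := Complex.norm_of_nonneg hr0
    (hconst r hnorm).trans (interpConst_le_worstInterpConst hr1 fun _ => hnorm.le)
  have hupper : worstInterpConst N n r ≤ ENNReal.ofReal (b₀ * Q) :=
    worstInterpConst_le hC.le hU hn hr0 hr1
  obtain ⟨heval_lower, heval_upper⟩ := evalNorm_estimates hc.le hU hL hn hr0 hr1
  have hmin : ENNReal.ofReal (min a₀ (a₀ / C) * Q) ≤ ENNReal.ofReal (a₀ * Q) := by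
    gcongr
    exact min_le_left _ _
  refine ⟨hmin.trans hlower, hupper.trans ?_, fun z hz => hmin.trans (hconst z hz),
    le_trans ?_ hlower, hupper.trans ?_⟩
  · gcongr
    exact le_max_left _ _
  · refine (mul_le_mul_right heval_upper _).trans ?_
    rw [← ENNReal.ofReal_mul ha.le, ← mul_assoc]
    gcongr
    exact (le_div_iff₀ hC).mp (min_le_right _ _)
  · refine le_trans ?_ (mul_le_mul_right heval_lower _)
    rw [← ENNReal.ofReal_mul hb.le, ← mul_assoc]
    gcongr
    exact (div_le_iff₀ (by positivity)).mp (le_max_right _ _)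

end Estimates

section Poisson

variable {f : ℂ → ℂ} {w : ℂ} {R p : ℝ}

theorem poissonKernel_eq_re_div (c w z : ℂ) :
    poissonKernel c w z = ((z - c + (w - c)) / ((z - c) - (w - c))).re :=
  congrFun poissonKernel_eq_re_herglotzRieszKernel z

theorem poissonKernel_circleMap_nonneg (hw : ‖w‖ < R) (θ : ℝ) :
    0 ≤ poissonKernel 0 w (circleMap 0 R θ) := by
  have hR : 0 ≤ R := (norm_nonneg w).trans hw.le
  rw [poissonKernel_eq_re_div]
  refine le_trans ?_ (le_re_herglotzRieszKernel (circleMap_mem_sphere 0 hR θ)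
    (mem_ball_zero_iff.mpr hw))
  rw [sub_zero]
  exact div_nonneg (sub_nonneg.mpr hw.le) (by positivity)

theorem poissonKernel_circleMap_le (hw : ‖w‖ < R) (θ : ℝ) :
    poissonKernel 0 w (circleMap 0 R θ) ≤ (R + ‖w‖) / (R - ‖w‖) := by
  rw [poissonKernel_eq_re_div]
  simpa only [sub_zero] using re_herglotzRieszKernel_le
    (circleMap_mem_sphere 0 ((norm_nonneg w).trans hw.le) θ) (mem_ball_zero_iff.mpr hw)

theorem continuous_poissonKernel_circleMap (hw : ‖w‖ < R) :
    Continuous fun θ => poissonKernel 0 w (circleMap 0 R θ) := by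
  simp only [poissonKernel_def, sub_zero]
  refine Continuous.div (by fun_prop) (by fun_prop) fun θ => pow_ne_zero 2 (norm_ne_zero_iff.mpr ?_)
  exact sub_ne_zero.mpr (circleMap_ne_mem_ball (mem_ball_zero_iff.mpr hw) θ)

/-- Harmonic measure at `w` of the circle of radius `R`, as a measure on the angles in
`(0, 2π]`. -/
def poissonMeasure (w : ℂ) (R : ℝ) : Measure ℝ :=
  (volume.restrict (Set.Ioc 0 (2 * Real.pi))).withDensity fun θ =>
    ENNReal.ofReal ((2 * Real.pi)⁻¹ * poissonKernel 0 w (circleMap 0 R θ))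

theorem measurable_poissonMeasure_density (hw : ‖w‖ < R) : Measurable fun θ =>
    ENNReal.ofReal ((2 * Real.pi)⁻¹ * poissonKernel 0 w (circleMap 0 R θ)) :=
  ((continuous_poissonKernel_circleMap hw).const_mul _).measurable.ennreal_ofReal

theorem integral_poissonMeasure (hw : ‖w‖ < R) (hf : DiffContOnCl ℂ f (Metric.ball 0 R)) :
    ∫ θ, f (circleMap 0 R θ) ∂poissonMeasure w R = f w := by
  rw [poissonMeasure, integral_withDensity_eq_integral_toReal_smul
    (measurable_poissonMeasure_density hw) (by simp),
    ← hf.circleAverage_poissonKernel_smul (mem_ball_zero_iff.mpr hw), Real.circleAverage_def,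
    intervalIntegral.integral_of_le Real.two_pi_pos.le, ← integral_smul]
  refine integral_congr_ae (.of_forall fun θ => ?_)
  simp only [Pi.smul_apply', smul_smul]
  rw [ENNReal.toReal_ofReal (mul_nonneg (by positivity) (poissonKernel_circleMap_nonneg hw θ))]

theorem isProbabilityMeasure_poissonMeasure (hw : ‖w‖ < R) :
    IsProbabilityMeasure (poissonMeasure w R) := by
  have hone := integral_poissonMeasure hw (f := fun _ => 1) diffContOnCl_const
  rw [integral_const, Complex.real_smul, mul_one] at hone
  exact ⟨(ENNReal.toReal_eq_one_iff _).mp (by exact_mod_cast hone)⟩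

theorem circleMean_rpow (hp : p ≠ 0) (f : ℂ → ℂ) (R : ℝ) : circleMean p f R ^ p =
    (ENNReal.ofReal (2 * Real.pi))⁻¹ *
      ∫⁻ θ in Set.Ioc 0 (2 * Real.pi), ‖f (circleMap 0 R θ)‖ₑ ^ p := by
  rw [circleMean, ← ENNReal.rpow_mul, one_div_mul_cancel hp, ENNReal.rpow_one]

theorem lintegral_poissonMeasure (hw : ‖w‖ < R) {G : ℝ → ℝ≥0∞} (hG : Measurable G) :
    ∫⁻ θ, G θ ∂poissonMeasure w R = (ENNReal.ofReal (2 * Real.pi))⁻¹ *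
      ∫⁻ θ in Set.Ioc 0 (2 * Real.pi),
        ENNReal.ofReal (poissonKernel 0 w (circleMap 0 R θ)) * G θ := by
  rw [poissonMeasure, lintegral_withDensity_eq_lintegral_mul _
    (measurable_poissonMeasure_density hw) hG, ← lintegral_const_mul' _ _ (by simp [Real.pi_pos])]
  refine lintegral_congr fun θ => ?_
  rw [Pi.mul_apply, ENNReal.ofReal_mul (by positivity), ENNReal.ofReal_inv_of_pos Real.two_pi_pos,
    mul_assoc]

theorem enorm_rpow_le_mul_circleMean_rpow (hp : 1 ≤ p) (hw : ‖w‖ < R)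
    (hf : DiffContOnCl ℂ f (Metric.ball 0 R)) :
    ‖f w‖ₑ ^ p ≤ ENNReal.ofReal ((R + ‖w‖) / (R - ‖w‖)) * circleMean p f R ^ p := by
  have hp0 : 0 < p := one_pos.trans_le hp
  have hR : 0 < R := (norm_nonneg w).trans_lt hw
  have hcont : Continuous fun θ => f (circleMap 0 R θ) := by
    refine hf.continuousOn.comp_continuous (continuous_circleMap 0 R) fun θ => ?_
    rw [closure_ball 0 hR.ne']
    exact circleMap_mem_closedBall 0 hR.le θ
  have := isProbabilityMeasure_poissonMeasure hw
  have hmean : ‖f w‖ₑ ≤ (∫⁻ θ, ‖f (circleMap 0 R θ)‖ₑ ^ p ∂poissonMeasure w R) ^ (1 / p) := by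
    rw [← integral_poissonMeasure hw hf]
    refine (enorm_integral_le_lintegral_enorm _).trans ?_
    simpa only [eLpNorm', div_one, ENNReal.rpow_one] using
      eLpNorm'_le_eLpNorm'_of_exponent_le one_pos hp (poissonMeasure w R)
        hcont.aestronglyMeasurable
  calc ‖f w‖ₑ ^ p ≤ ∫⁻ θ, ‖f (circleMap 0 R θ)‖ₑ ^ p ∂poissonMeasure w R := by
        simpa only [← ENNReal.rpow_mul, one_div_mul_cancel hp0.ne', ENNReal.rpow_one] using
          ENNReal.rpow_le_rpow hmean hp0.le
    _ ≤ (ENNReal.ofReal (2 * Real.pi))⁻¹ * ∫⁻ θ in Set.Ioc 0 (2 * Real.pi),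
          ENNReal.ofReal ((R + ‖w‖) / (R - ‖w‖)) * ‖f (circleMap 0 R θ)‖ₑ ^ p := by
        rw [lintegral_poissonMeasure hw (hcont.measurable.enorm.pow_const p)]
        gcongr with θ
        exact poissonKernel_circleMap_le hw θ
    _ = ENNReal.ofReal ((R + ‖w‖) / (R - ‖w‖)) * circleMean p f R ^ p := by
        rw [lintegral_const_mul' _ _ ENNReal.ofReal_ne_top, circleMean_rpow hp0.ne', mul_left_comm]

theorem norm_le_mul_rpow_of_enorm_rpow_le (hp : 0 < p) {K d q : ℝ} (hK : 0 ≤ K) (hd : 0 < d) {z : ℂ}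
    (h : ‖z‖ₑ ^ p ≤ ENNReal.ofReal (K * d ^ (-q))) : ‖z‖ ≤ K ^ (1 / p) * d ^ (-(q / p)) := by
  rw [← ofReal_norm, ENNReal.ofReal_rpow_of_nonneg (norm_nonneg z) hp.le,
    ENNReal.ofReal_le_ofReal_iff (by positivity)] at h
  have hroot := Real.rpow_le_rpow (by positivity) h (by positivity : 0 ≤ 1 / p)
  rwa [← Real.rpow_mul (norm_nonneg z), mul_one_div_cancel hp.ne', Real.rpow_one,
    Real.mul_rpow hK (by positivity), ← Real.rpow_mul hd.le, mul_one_div, neg_div] at hroot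

end Poisson

section Hardy

variable {p s : ℝ} {k : ℕ} {ζ : ℂ}

theorem norm_le_of_mem_unitBall_hardyNorm (hp : 1 ≤ p) {f : ℂ → ℂ} (hf : f ∈ unitBall (hardyNorm p))
    {w : ℂ} (hw : w ∈ disc) : ‖f w‖ ≤ 4 ^ (1 / p) * (1 - ‖w‖) ^ (-(1 / p)) := by
  have hw1 : 0 < 1 - ‖w‖ := sub_pos.mpr (mem_ball_zero_iff.mp hw)
  have hp0 : 0 < p := one_pos.trans_le hp
  set R := (1 + ‖w‖) / 2 with hR
  have hR0 : 0 ≤ R := by positivity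
  have hR1 : R < 1 := by linarith
  have hmean : circleMean p f R ^ p ≤ 1 := by
    refine ENNReal.rpow_le_one (le_trans ?_ hf.2) hp0.le
    exact le_iSup₂ (f := fun ρ (_ : ρ ∈ Set.Ico (0 : ℝ) 1) => circleMean p f ρ) R ⟨hR0, hR1⟩
  have hconst : (R + ‖w‖) / (R - ‖w‖) ≤ 4 * (1 - ‖w‖) ^ (-1 : ℝ) := by
    rw [Real.rpow_neg_one, ← div_eq_mul_inv, div_le_div_iff₀ (by linarith) hw1]
    nlinarith [norm_nonneg w]
  refine norm_le_mul_rpow_of_enorm_rpow_le hp0 (by norm_num) hw1 ?_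
  calc ‖f w‖ₑ ^ p ≤ ENNReal.ofReal ((R + ‖w‖) / (R - ‖w‖)) * circleMean p f R ^ p :=
        enorm_rpow_le_mul_circleMean_rpow hp (by linarith)
          (hf.1.diffContOnCl_ball (Metric.closedBall_subset_ball hR1))
    _ ≤ ENNReal.ofReal (4 * (1 - ‖w‖) ^ (-1 : ℝ)) * 1 :=
        mul_le_mul' (ENNReal.ofReal_le_ofReal hconst) hmean
    _ = _ := mul_one _

theorem norm_one_sub_conj_mul_circleMap (ζ : ℂ) (ρ θ : ℝ) :
    ‖1 - conj ζ * circleMap 0 ρ θ‖ = ‖circleMap 0 1 θ - ρ * ζ‖ := by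
  set e := Complex.exp (θ * Complex.I) with he
  have hnorm : ‖e‖ = 1 := Complex.norm_exp_ofReal_mul_I θ
  have hunit : e * conj e = 1 := by
    rw [Complex.mul_conj', hnorm, Complex.ofReal_one, one_pow]
  have hfactor : circleMap 0 1 θ - ρ * ζ = conj (1 - conj ζ * circleMap 0 ρ θ) * e := by
    simp only [circleMap, zero_add, ← he, map_sub, map_one, map_mul, Complex.conj_conj,
      Complex.conj_ofReal, Complex.ofReal_one, one_mul]
    linear_combination (ρ * ζ) * hunit
  rw [hfactor, norm_mul, hnorm, mul_one, RCLike.norm_conj]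

theorem rpow_norm_circleMap_sub_le_poissonKernel {w : ℂ} (hw : ‖w‖ < 1) {q : ℝ} (hq : 2 ≤ q)
    (θ : ℝ) : ‖circleMap 0 1 θ - w‖ ^ (-q) ≤
      (1 - ‖w‖) ^ (1 - q) * poissonKernel 0 w (circleMap 0 1 θ) := by
  have hw0 : 0 < 1 - ‖w‖ := sub_pos.mpr hw
  have hcircle : ‖circleMap 0 1 θ‖ = 1 := by rw [norm_circleMap_zero, abs_one]
  have hD : 1 - ‖w‖ ≤ ‖circleMap 0 1 θ - w‖ := by
    simpa only [hcircle] using norm_sub_norm_le (circleMap 0 1 θ) w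
  rw [poissonKernel_def, sub_zero, sub_zero, hcircle]
  set D := ‖circleMap 0 1 θ - w‖
  have hD0 : 0 < D := hw0.trans_le hD
  calc D ^ (-q) = D ^ (2 - q) / D ^ 2 := by
        rw [← Real.rpow_two, ← Real.rpow_sub hD0, sub_sub_cancel_left]
    _ ≤ (1 - ‖w‖) ^ (2 - q) / D ^ 2 := by
        gcongr ?_ / _
        exact Real.rpow_le_rpow_of_nonpos hw0 hD (by linarith)
    _ = (1 - ‖w‖) ^ (1 - q) * ((1 - ‖w‖) / D ^ 2) := by
        rw [show 2 - q = 1 - q + 1 by ring, Real.rpow_add_one hw0.ne', mul_div_assoc]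
    _ ≤ (1 - ‖w‖) ^ (1 - q) * ((1 ^ 2 - ‖w‖ ^ 2) / D ^ 2) := by
        gcongr
        · norm_num
        · exact pow_le_of_le_one (norm_nonneg w) hw.le two_ne_zero

theorem norm_normalizedKernel_rpow (hp : p ≠ 0) (hζ : ‖ζ‖ < 1) {z : ℂ} (hz : ‖z‖ ≤ 1) :
    ‖normalizedKernel (s / p) k ζ z‖ ^ p =
      (1 - ‖ζ‖) ^ (k * p - s) * ‖1 - conj ζ * z‖ ^ (-(k * p)) := by
  have hδ : 0 < 1 - ‖ζ‖ := sub_pos.mpr hζ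
  have hD : 0 < ‖1 - conj ζ * z‖ := norm_pos_iff.mpr (one_sub_conj_mul_ne_zero hζ hz)
  rw [norm_normalizedKernel hζ, Real.mul_rpow (by positivity) (by positivity),
    ← Real.rpow_mul hδ.le, ← Real.rpow_natCast, ← Real.rpow_mul (by positivity),
    Real.div_rpow hδ.le hD.le, neg_mul, div_mul_cancel₀ s hp, Real.rpow_neg hD.le,
    ← mul_div_assoc, ← Real.rpow_add hδ, neg_add_eq_sub, div_eq_mul_inv]

theorem circleMean_normalizedKernel_rpow_le (hp : 0 < p) (hkp : 2 ≤ k * p) (hζ : ‖ζ‖ < 1) {ρ : ℝ}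
    (hρ0 : 0 ≤ ρ) (hρ1 : ρ < 1) :
    circleMean p (normalizedKernel (s / p) k ζ) ρ ^ p ≤
      ENNReal.ofReal ((1 - ‖ζ‖) ^ (k * p - s) * (1 - ‖ζ‖ * ρ) ^ (1 - k * p)) := by
  have hw : ‖(ρ : ℂ) * ζ‖ = ‖ζ‖ * ρ := by rw [norm_mul, Complex.norm_of_nonneg hρ0, mul_comm]
  have hw1 : ‖(ρ : ℂ) * ζ‖ < 1 := hw.trans_lt (mul_lt_one_of_nonneg_of_lt_one_left
    (norm_nonneg ζ) hζ hρ1.le)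
  set κ := (1 - ‖ζ‖) ^ (k * p - s) * (1 - ‖ζ‖ * ρ) ^ (1 - k * p)
  have : 0 < 1 - ‖ζ‖ := sub_pos.mpr hζ
  have hpoint : ∀ θ, ‖normalizedKernel (s / p) k ζ (circleMap 0 ρ θ)‖ₑ ^ p ≤
      ENNReal.ofReal (poissonKernel 0 (ρ * ζ) (circleMap 0 1 θ)) * ENNReal.ofReal κ := fun θ => by
    have hz : ‖circleMap 0 ρ θ‖ ≤ 1 := by rw [norm_circleMap_zero, abs_of_nonneg hρ0]; exact hρ1.le
    rw [← ofReal_norm, ENNReal.ofReal_rpow_of_nonneg (norm_nonneg _) hp.le,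
      ← ENNReal.ofReal_mul (poissonKernel_circleMap_nonneg hw1 θ), mul_comm,
      norm_normalizedKernel_rpow hp.ne' hζ hz, norm_one_sub_conj_mul_circleMap, mul_assoc]
    gcongr
    simpa only [hw] using rpow_norm_circleMap_sub_le_poissonKernel hw1 hkp θ
  have := isProbabilityMeasure_poissonMeasure hw1
  calc circleMean p (normalizedKernel (s / p) k ζ) ρ ^ p
      ≤ ∫⁻ _, ENNReal.ofReal κ ∂poissonMeasure (ρ * ζ) 1 := by
        rw [circleMean_rpow hp.ne', lintegral_poissonMeasure hw1 measurable_const]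
        gcongr with θ
        exact hpoint θ
    _ = ENNReal.ofReal κ := by rw [lintegral_const, measure_univ, mul_one]

theorem normalizedKernel_mem_unitBall_hardyNorm (hp : 1 ≤ p) (hζ : ζ ∈ disc) :
    normalizedKernel (1 / p) 2 ζ ∈ unitBall (hardyNorm p) := by
  have hζ1 : ‖ζ‖ < 1 := mem_ball_zero_iff.mp hζ
  have hδ : 0 < 1 - ‖ζ‖ := sub_pos.mpr hζ1
  have hp0 : 0 < p := one_pos.trans_le hp
  refine ⟨differentiableOn_normalizedKernel hζ1, iSup₂_le fun ρ hρ => ?_⟩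
  rw [← ENNReal.rpow_le_rpow_iff hp0, ENNReal.one_rpow]
  refine (circleMean_normalizedKernel_rpow_le hp0 (by push_cast; linarith) hζ1 hρ.1 hρ.2).trans ?_
  rw [ENNReal.ofReal_le_one]
  calc (1 - ‖ζ‖) ^ ((2 : ℕ) * p - 1) * (1 - ‖ζ‖ * ρ) ^ (1 - (2 : ℕ) * p)
      ≤ (1 - ‖ζ‖) ^ ((2 : ℕ) * p - 1) * (1 - ‖ζ‖) ^ (1 - (2 : ℕ) * p) := by
        gcongr ?_ * ?_
        refine Real.rpow_le_rpow_of_nonpos hδ ?_ (by push_cast; linarith)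
        exact sub_le_sub_left (mul_le_of_le_one_right (norm_nonneg ζ) hρ.2.le) 1
    _ = 1 := by rw [← Real.rpow_add hδ, sub_add_sub_cancel, sub_self, Real.rpow_zero]

end Hardy

section Polar

theorem lintegral_eq_lintegral_circleMap {F : ℂ → ℝ≥0∞} (hF : Measurable F) :
    ∫⁻ z, F z = ∫⁻ ρ in Set.Ioi 0, ENNReal.ofReal ρ *
      ∫⁻ θ in Set.Ioc 0 (2 * Real.pi), F (circleMap 0 ρ θ) := by
  have hpolar : ∀ q : ℝ × ℝ, Complex.polarCoord.symm q = circleMap 0 q.1 q.2 := fun q => by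
    rw [Complex.polarCoord_symm_apply, circleMap, zero_add, Complex.exp_mul_I, Complex.ofReal_cos,
      Complex.ofReal_sin]
  have : Measurable fun q : ℝ × ℝ => F (circleMap 0 q.1 q.2) :=
    hF.comp (by unfold circleMap; fun_prop)
  rw [← Complex.lintegral_comp_polarCoord_symm]
  simp only [hpolar, smul_eq_mul, polarCoord_target]
  rw [Measure.volume_eq_prod, ← Measure.prod_restrict, lintegral_prod _ (by fun_prop)]
  refine lintegral_congr fun ρ => ?_
  simp only
  rw [lintegral_const_mul' _ _ ENNReal.ofReal_ne_top, setLIntegral_congr Ioo_ae_eq_Ioc]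
  congr 1
  have hdomain := isAddFundamentalDomain_Ioc Real.two_pi_pos (-Real.pi)
  have hdomain' := isAddFundamentalDomain_Ioc Real.two_pi_pos 0
  rw [show -Real.pi + 2 * Real.pi = Real.pi by ring] at hdomain
  rw [zero_add] at hdomain'
  refine hdomain.setLIntegral_eq hdomain' _ ?_
  rintro ⟨_, m, rfl⟩ θ
  have hperiodic : Function.Periodic (fun θ => F (circleMap 0 ρ θ)) (2 * Real.pi) :=
    (periodic_circleMap 0 ρ).comp F
  simpa [AddSubgroup.vadd_def, add_comm] using hperiodic.zsmul m θ

theorem setLIntegral_ball_eq_lintegral_circleMap {F : ℂ → ℝ≥0∞} {R : ℝ}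
    (hF : Measurable ((Metric.ball 0 R).indicator F)) :
    ∫⁻ z in Metric.ball 0 R, F z = ∫⁻ ρ in Set.Ioo 0 R, ENNReal.ofReal ρ *
      ∫⁻ θ in Set.Ioc 0 (2 * Real.pi), F (circleMap 0 ρ θ) := by
  rw [← lintegral_indicator measurableSet_ball, lintegral_eq_lintegral_circleMap hF,
    ← Set.Ioi_inter_Iio, Set.inter_comm, ← setLIntegral_indicator measurableSet_Iio]
  refine setLIntegral_congr_fun measurableSet_Ioi fun ρ hρ => ?_
  have hmem : ∀ θ, circleMap 0 ρ θ ∈ Metric.ball 0 R ↔ ρ < R := fun θ => by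
    rw [mem_ball_zero_iff, norm_circleMap_zero, abs_of_pos hρ]
  by_cases hR : ρ < R <;> simp [Set.indicator, hmem, hR]

end Polar

section BergmanNorm

variable {p β : ℝ} {f : ℂ → ℂ}

theorem measurable_indicator_bergman_integrand (hp : 0 < p) (hf : ContinuousOn f disc) :
    Measurable (disc.indicator fun z => ‖f z‖ₑ ^ p * ENNReal.ofReal ((1 - ‖z‖ ^ 2) ^ β)) := by
  classical
  have hfm : Measurable (disc.indicator f) := by
    rw [← Set.piecewise_eq_indicator]
    exact hf.measurable_piecewise continuousOn_const measurableSet_ball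
  have hweight : Measurable fun z : ℂ => ENNReal.ofReal ((1 - ‖z‖ ^ 2) ^ β) := by fun_prop
  convert (hfm.enorm.pow_const p).mul hweight using 1
  ext z
  rw [Pi.mul_apply]
  by_cases hz : z ∈ disc
  · rw [Set.indicator_of_mem hz, Set.indicator_of_mem hz]
  · rw [Set.indicator_of_notMem hz, Set.indicator_of_notMem hz, enorm_zero,
      ENNReal.zero_rpow_of_pos hp, zero_mul]

theorem lintegral_circleMap_bergman_integrand (hp : p ≠ 0) {ρ : ℝ} (hρ : 0 ≤ ρ) :
    (ENNReal.ofReal Real.pi)⁻¹ * (ENNReal.ofReal ρ * ∫⁻ θ in Set.Ioc 0 (2 * Real.pi),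
      ‖f (circleMap 0 ρ θ)‖ₑ ^ p * ENNReal.ofReal ((1 - ‖circleMap 0 ρ θ‖ ^ 2) ^ β)) =
      ENNReal.ofReal (2 * ρ * (1 - ρ ^ 2) ^ β) * circleMean p f ρ ^ p := by
  have htwo : ENNReal.ofReal 2 * (ENNReal.ofReal 2)⁻¹ = 1 :=
    ENNReal.mul_inv_cancel (by simp) ENNReal.ofReal_ne_top
  simp only [norm_circleMap_zero, abs_of_nonneg hρ]
  rw [lintegral_mul_const' _ _ ENNReal.ofReal_ne_top, circleMean_rpow hp,
    ENNReal.ofReal_mul (by positivity), ENNReal.ofReal_mul zero_le_two,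
    ENNReal.ofReal_mul zero_le_two, ENNReal.mul_inv (.inr ENNReal.ofReal_ne_top)
      (.inl ENNReal.ofReal_ne_top)]
  set S := ∫⁻ θ in Set.Ioc 0 (2 * Real.pi), ‖f (circleMap 0 ρ θ)‖ₑ ^ p
  calc (ENNReal.ofReal Real.pi)⁻¹ * (ENNReal.ofReal ρ * (S * ENNReal.ofReal ((1 - ρ ^ 2) ^ β)))
      = ENNReal.ofReal 2 * (ENNReal.ofReal 2)⁻¹ * ((ENNReal.ofReal Real.pi)⁻¹ *
          (ENNReal.ofReal ρ * (S * ENNReal.ofReal ((1 - ρ ^ 2) ^ β)))) := by rw [htwo, one_mul]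
    _ = _ := by ring

theorem bergmanNorm_rpow (hp : 0 < p) (hf : ContinuousOn f disc) :
    bergmanNorm p β f ^ p = ∫⁻ ρ in Set.Ioo 0 1,
      ENNReal.ofReal (2 * ρ * (1 - ρ ^ 2) ^ β) * circleMean p f ρ ^ p := by
  rw [bergmanNorm, ← ENNReal.rpow_mul, one_div_mul_cancel hp.ne', ENNReal.rpow_one,
    setLIntegral_ball_eq_lintegral_circleMap (measurable_indicator_bergman_integrand hp hf),
    ← lintegral_const_mul' _ _ (by simp [Real.pi_pos])]
  exact setLIntegral_congr_fun measurableSet_Ioo fun ρ hρ =>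
    lintegral_circleMap_bergman_integrand hp.ne' hρ.1.le

theorem bergmanNorm_const_smul (hp : 0 < p) (c : ℂ) :
    bergmanNorm p β (c • f) = ‖c‖ₑ * bergmanNorm p β f := by
  have hc : ‖c‖ₑ ^ p ≠ ⊤ := ENNReal.rpow_ne_top_of_nonneg hp.le enorm_ne_top
  simp only [bergmanNorm, Pi.smul_apply, enorm_smul, ENNReal.mul_rpow_of_nonneg _ _ hp.le,
    mul_assoc]
  rw [lintegral_const_mul' _ _ hc, mul_left_comm, ENNReal.mul_rpow_of_nonneg _ _ (by positivity),
    ← ENNReal.rpow_mul, mul_one_div_cancel hp.ne', ENNReal.rpow_one]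

end BergmanNorm

section BergmanPointwise

variable {p β : ℝ} {f : ℂ → ℂ} {w : ℂ}

theorem rpow_le_mul_rpow {x y L : ℝ} (hx : 0 < x) (hy : 0 < y) (hxy : x ≤ L * y) (hyx : y ≤ L * x)
    (β : ℝ) : x ^ β ≤ L ^ |β| * y ^ β := by
  have hL : 0 < L := pos_of_mul_pos_left (hx.trans_le hxy) hy.le
  rcases le_total 0 β with hβ | hβ
  · rw [abs_of_nonneg hβ, ← Real.mul_rpow hL.le hy.le]
    exact Real.rpow_le_rpow hx.le hxy hβ
  · rw [abs_of_nonpos hβ, Real.rpow_neg hL.le, ← Real.inv_rpow hL.le,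
      ← Real.mul_rpow (inv_nonneg.mpr hL.le) hy.le]
    exact Real.rpow_le_rpow_of_nonpos (by positivity) ((inv_mul_le_iff₀ hL).mpr hyx) hβ

theorem enorm_rpow_le_mul_weight_mul_circleMean_rpow (hp : 1 ≤ p) (hf : DifferentiableOn ℂ f disc)
    (hw : ‖w‖ < 1) {R : ℝ} (hR : R ∈ Set.Ioo (1 - (1 - ‖w‖) / 2) (1 - (1 - ‖w‖) / 4)) :
    ‖f w‖ₑ ^ p ≤ ENNReal.ofReal (4 * 4 ^ |β| * (1 - ‖w‖) ^ (-(1 + β))) *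
      (ENNReal.ofReal (2 * R * (1 - R ^ 2) ^ β) * circleMean p f R ^ p) := by
  obtain ⟨hR1, hR2⟩ := hR
  have hw0 := norm_nonneg w
  have hd : 0 < 1 - ‖w‖ := sub_pos.mpr hw
  have hx : 0 < 1 - R ^ 2 := by nlinarith
  have hcoef : (R + ‖w‖) / (R - ‖w‖) ≤ 4 / (1 - ‖w‖) := by
    rw [div_le_div_iff₀ (by linarith) hd]
    nlinarith
  have hweight : (1 - ‖w‖) ^ β ≤ 4 ^ |β| * (2 * R * (1 - R ^ 2) ^ β) :=
    (rpow_le_mul_rpow hd hx (by nlinarith) (by nlinarith) β).trans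
      (mul_le_mul_of_nonneg_left (le_mul_of_one_le_left (by positivity) (by linarith))
        (by positivity))
  refine (enorm_rpow_le_mul_circleMean_rpow hp (by linarith : ‖w‖ < R)
    (hf.diffContOnCl_ball (Metric.closedBall_subset_ball (by linarith)))).trans ?_
  rw [← mul_assoc, ← ENNReal.ofReal_mul (by positivity)]
  gcongr
  calc (R + ‖w‖) / (R - ‖w‖) ≤ 4 * (1 - ‖w‖) ^ (-(1 + β)) * (1 - ‖w‖) ^ β := by
        rwa [mul_assoc, ← Real.rpow_add hd, neg_add_rev, neg_add_cancel_comm, Real.rpow_neg_one,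
          ← div_eq_mul_inv]
    _ ≤ 4 * (1 - ‖w‖) ^ (-(1 + β)) * (4 ^ |β| * (2 * R * (1 - R ^ 2) ^ β)) := by gcongr
    _ = 4 * 4 ^ |β| * (1 - ‖w‖) ^ (-(1 + β)) * (2 * R * (1 - R ^ 2) ^ β) := by ring

theorem norm_le_of_mem_unitBall_bergmanNorm (hp : 1 ≤ p) (hf : f ∈ unitBall (bergmanNorm p β))
    (hw : w ∈ disc) :
    ‖f w‖ ≤ (16 * 4 ^ |β|) ^ (1 / p) * (1 - ‖w‖) ^ (-((2 + β) / p)) := by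
  have hp0 : 0 < p := one_pos.trans_le hp
  have hw1 : ‖w‖ < 1 := mem_ball_zero_iff.mp hw
  refine norm_le_mul_rpow_of_enorm_rpow_le hp0 (by positivity) (sub_pos.mpr hw1) ?_
  set d := 1 - ‖w‖
  have hd : 0 < d := sub_pos.mpr hw1
  have hd1 : d ≤ 1 := sub_le_self 1 (norm_nonneg w)
  set κ := 4 * 4 ^ |β| * d ^ (-(1 + β)) with hκ
  have haverage : ‖f w‖ₑ ^ p * ENNReal.ofReal (d / 4) ≤ ENNReal.ofReal κ := by
    calc ‖f w‖ₑ ^ p * ENNReal.ofReal (d / 4)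
        = ∫⁻ _ in Set.Ioo (1 - d / 2) (1 - d / 4), ‖f w‖ₑ ^ p := by
          rw [setLIntegral_const, Real.volume_Ioo]
          ring_nf
      _ ≤ ∫⁻ R in Set.Ioo (1 - d / 2) (1 - d / 4), ENNReal.ofReal κ *
            (ENNReal.ofReal (2 * R * (1 - R ^ 2) ^ β) * circleMean p f R ^ p) :=
          setLIntegral_mono' measurableSet_Ioo fun R hR =>
            enorm_rpow_le_mul_weight_mul_circleMean_rpow hp hf.1 hw1 hR
      _ ≤ ∫⁻ R in Set.Ioo 0 1, ENNReal.ofReal κ *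
            (ENNReal.ofReal (2 * R * (1 - R ^ 2) ^ β) * circleMean p f R ^ p) :=
          lintegral_mono_set (Set.Ioo_subset_Ioo (by linarith) (by linarith))
      _ = ENNReal.ofReal κ * bergmanNorm p β f ^ p := by
          rw [lintegral_const_mul' _ _ ENNReal.ofReal_ne_top,
            bergmanNorm_rpow hp0 hf.1.continuousOn]
      _ ≤ ENNReal.ofReal κ := mul_le_of_le_one_right' (ENNReal.rpow_le_one hf.2 hp0.le)
  have hκd : κ / (d / 4) = 16 * 4 ^ |β| * d ^ (-(2 + β)) := by
    rw [show -(1 + β) = -(2 + β) + 1 by ring, Real.rpow_add_one hd.ne'] at hκ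
    rw [hκ]
    field_simp
    norm_num
  rw [← hκd, ENNReal.ofReal_div_of_pos (by positivity)]
  exact (ENNReal.le_div_iff_mul_le (.inl (by simpa using hd)) (.inl ENNReal.ofReal_ne_top)).mpr
    haverage

end BergmanPointwise

section BergmanKernel

variable {p β : ℝ} {k : ℕ} {ζ : ℂ}

theorem hasDerivAt_neg_div_rpow {δ x : ℝ} (hβ : β + 1 ≠ 0) (hδ : 0 < δ) (hx : x < 1) :
    HasDerivAt (fun ρ => -(((1 - ρ) / (1 - ρ + δ)) ^ (β + 1) / ((β + 1) * δ)))
      ((1 - x) ^ β * (1 - x + δ) ^ (-(β + 2))) x := by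
  have hx0 : 0 < 1 - x := sub_pos.mpr hx
  have hxδ : 0 < 1 - x + δ := by positivity
  have hnum : HasDerivAt (fun ρ : ℝ => 1 - ρ) (-1) x := by
    simpa using (hasDerivAt_id x).const_sub 1
  have hquot := hnum.div (hnum.add_const δ) hxδ.ne'
  have hpow := hquot.rpow_const (p := β + 1) (.inl (div_pos hx0 hxδ).ne')
  refine (hpow.div_const ((β + 1) * δ)).neg.congr_deriv ?_
  simp only [Pi.div_apply]
  rw [add_sub_cancel_right, Real.div_rpow hx0.le hxδ.le, Real.rpow_neg hxδ.le,
    Real.rpow_add hxδ, Real.rpow_two]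
  have := Real.rpow_pos_of_pos hxδ β
  field_simp
  ring

theorem lintegral_rpow_mul_rpow_neg_le {δ : ℝ} (hβ : -1 < β) (hδ : 0 < δ) :
    ∫⁻ ρ in Set.Ioo 0 1, ENNReal.ofReal ((1 - ρ) ^ β * (1 - ρ + δ) ^ (-(β + 2))) ≤
      ENNReal.ofReal (1 / ((β + 1) * δ)) := by
  have hβ1 : 0 < β + 1 := by linarith
  set g : ℝ → ℝ := fun ρ => -(((1 - ρ) / (1 - ρ + δ)) ^ (β + 1) / ((β + 1) * δ)) with hg
  set g' : ℝ → ℝ := fun ρ => (1 - ρ) ^ β * (1 - ρ + δ) ^ (-(β + 2))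
  have hcont : ContinuousOn g (Set.Icc 0 1) := by
    refine ((ContinuousOn.rpow_const (.div (by fun_prop) (by fun_prop) fun x hx => ?_)
      fun _ _ => .inr hβ1.le).div_const _).neg
    linarith [hx.2]
  have hderiv : ∀ x ∈ Set.Ioo (0 : ℝ) 1, HasDerivAt g (g' x) x := fun x hx =>
    hasDerivAt_neg_div_rpow hβ1.ne' hδ hx.2
  have hpos : ∀ x ∈ Set.Ioo (0 : ℝ) 1, 0 ≤ g' x := fun x hx => by
    have : 0 < 1 - x := sub_pos.mpr hx.2
    positivity
  have hint : IntegrableOn g' (Set.Ioc 0 1) :=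
    intervalIntegral.integrableOn_deriv_of_nonneg hcont hderiv hpos
  have hg1 : g 1 = 0 := by
    simp only [hg, sub_self, zero_div, Real.zero_rpow hβ1.ne', neg_zero]
  have hg0 : -g 0 ≤ 1 / ((β + 1) * δ) := by
    simp only [hg, sub_zero, neg_neg]
    gcongr
    exact Real.rpow_le_one (by positivity) (div_le_one_of_le₀ (by linarith) (by positivity)) hβ1.le
  rw [← ofReal_integral_eq_lintegral_ofReal (hint.mono_set Set.Ioo_subset_Ioc_self)
    (ae_restrict_of_forall_mem measurableSet_Ioo hpos),
    ← integral_Ioc_eq_integral_Ioo, ← intervalIntegral.integral_of_le zero_le_one,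
    intervalIntegral.integral_eq_sub_of_hasDerivAt_of_le zero_le_one hcont hderiv
      ((intervalIntegrable_iff_integrableOn_Ioc_of_le zero_le_one).mpr hint), hg1, zero_sub]
  exact ENNReal.ofReal_le_ofReal hg0

theorem rpow_one_sub_mul_le {t ρ q : ℝ} (ht0 : 0 ≤ t) (ht1 : t < 1) (hρ0 : 0 ≤ ρ) (hρ1 : ρ < 1)
    (hβ : -1 < β) (hq : β + 3 ≤ q) : (1 - t * ρ) ^ (1 - q) ≤
      2 ^ (q - 1) * ((1 - t) ^ (-(q - 3 - β)) * (1 - ρ + (1 - t)) ^ (-(β + 2))) := by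
  have hδ : 0 < 1 - t := sub_pos.mpr ht1
  have hy : 0 < 1 - ρ + (1 - t) := by linarith
  calc (1 - t * ρ) ^ (1 - q) ≤ ((1 - ρ + (1 - t)) / 2) ^ (1 - q) :=
        Real.rpow_le_rpow_of_nonpos (by positivity) (by nlinarith) (by linarith)
    _ = 2 ^ (q - 1) * ((1 - ρ + (1 - t)) ^ (-(q - 3 - β)) * (1 - ρ + (1 - t)) ^ (-(β + 2))) := by
        rw [← Real.rpow_add hy, Real.div_rpow hy.le zero_le_two, div_eq_inv_mul,
          ← Real.rpow_neg zero_le_two, neg_sub]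
        ring_nf
    _ ≤ 2 ^ (q - 1) * ((1 - t) ^ (-(q - 3 - β)) * (1 - ρ + (1 - t)) ^ (-(β + 2))) := by
        gcongr ?_ * (?_ * _)
        exact Real.rpow_le_rpow_of_nonpos hδ (by linarith) (by linarith)

theorem weight_mul_rpow_one_sub_mul_le {t ρ q : ℝ} (ht0 : 0 ≤ t) (ht1 : t < 1) (hρ0 : 0 ≤ ρ)
    (hρ1 : ρ < 1) (hβ : -1 < β) (hq : β + 3 ≤ q) :
    2 * ρ * (1 - ρ ^ 2) ^ β * ((1 - t) ^ (q - (2 + β)) * (1 - t * ρ) ^ (1 - q)) ≤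
      2 ^ (|β| + q) * (1 - t) * ((1 - ρ) ^ β * (1 - ρ + (1 - t)) ^ (-(β + 2))) := by
  have hδ : 0 < 1 - t := sub_pos.mpr ht1
  have hx : 0 < 1 - ρ := sub_pos.mpr hρ1
  have hx2 : 0 < 1 - ρ ^ 2 := by nlinarith
  have htρ : 0 < 1 - t * ρ := by nlinarith
  have hδpow : (1 - t) ^ (q - (2 + β)) * (1 - t) ^ (-(q - 3 - β)) = 1 - t := by
    rw [← Real.rpow_add hδ, show q - (2 + β) + -(q - 3 - β) = 1 by ring, Real.rpow_one]
  have htwo : (2 : ℝ) ^ (|β| + q) = 2 * 2 ^ |β| * 2 ^ (q - 1) := by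
    rw [Real.rpow_add two_pos, Real.rpow_sub_one two_ne_zero]
    ring
  calc 2 * ρ * (1 - ρ ^ 2) ^ β * ((1 - t) ^ (q - (2 + β)) * (1 - t * ρ) ^ (1 - q))
      ≤ 2 * 1 * (2 ^ |β| * (1 - ρ) ^ β) * ((1 - t) ^ (q - (2 + β)) * (2 ^ (q - 1) *
          ((1 - t) ^ (-(q - 3 - β)) * (1 - ρ + (1 - t)) ^ (-(β + 2))))) := by
        gcongr
        · exact rpow_le_mul_rpow hx2 hx (by nlinarith) (by nlinarith) β
        · exact rpow_one_sub_mul_le ht0 ht1 hρ0 hρ1 hβ hq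
    _ = 2 ^ (|β| + q) * (1 - t) * ((1 - ρ) ^ β * (1 - ρ + (1 - t)) ^ (-(β + 2))) := by
        rw [htwo]
        linear_combination (2 * 2 ^ |β| * 2 ^ (q - 1) * (1 - ρ) ^ β *
          (1 - ρ + (1 - t)) ^ (-(β + 2))) * hδpow

theorem bergmanNorm_normalizedKernel_rpow_le (hp : 0 < p) (hβ : -1 < β) (hkp : β + 3 ≤ k * p)
    (hζ : ‖ζ‖ < 1) : bergmanNorm p β (normalizedKernel ((2 + β) / p) k ζ) ^ p ≤
      ENNReal.ofReal (2 ^ (|β| + k * p) / (β + 1)) := by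
  have hβ1 : 0 < β + 1 := by linarith
  have hδ : 0 < 1 - ‖ζ‖ := sub_pos.mpr hζ
  rw [bergmanNorm_rpow hp (differentiableOn_normalizedKernel hζ).continuousOn]
  calc ∫⁻ ρ in Set.Ioo 0 1, ENNReal.ofReal (2 * ρ * (1 - ρ ^ 2) ^ β) *
        circleMean p (normalizedKernel ((2 + β) / p) k ζ) ρ ^ p
      ≤ ∫⁻ ρ in Set.Ioo 0 1, ENNReal.ofReal (2 ^ (|β| + k * p) * (1 - ‖ζ‖)) *
          ENNReal.ofReal ((1 - ρ) ^ β * (1 - ρ + (1 - ‖ζ‖)) ^ (-(β + 2))) := by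
        refine setLIntegral_mono' measurableSet_Ioo fun ρ ⟨hρ0, hρ1⟩ => ?_
        have hx2 : 0 < 1 - ρ ^ 2 := by nlinarith
        refine (mul_le_mul_right (circleMean_normalizedKernel_rpow_le hp (by linarith) hζ hρ0.le
          hρ1) _).trans ?_
        rw [← ENNReal.ofReal_mul (by positivity), ← ENNReal.ofReal_mul (by positivity)]
        exact ENNReal.ofReal_le_ofReal
          (weight_mul_rpow_one_sub_mul_le (norm_nonneg ζ) hζ hρ0.le hρ1 hβ hkp)
    _ ≤ ENNReal.ofReal (2 ^ (|β| + k * p) * (1 - ‖ζ‖)) *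
          ENNReal.ofReal (1 / ((β + 1) * (1 - ‖ζ‖))) := by
        rw [lintegral_const_mul' _ _ ENNReal.ofReal_ne_top]
        gcongr
        exact lintegral_rpow_mul_rpow_neg_le hβ hδ
    _ = ENNReal.ofReal (2 ^ (|β| + k * p) / (β + 1)) := by
        rw [← ENNReal.ofReal_mul (by positivity)]
        congr 1
        field_simp

theorem const_smul_normalizedKernel_mem_unitBall_bergmanNorm (hp : 0 < p) (hβ : -1 < β)
    (hkp : β + 3 ≤ k * p) (hζ : ζ ∈ disc) :
    (((2 ^ (|β| + k * p) / (β + 1)) ^ (-(1 / p)) : ℝ) : ℂ) •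
      normalizedKernel ((2 + β) / p) k ζ ∈ unitBall (bergmanNorm p β) := by
  have hζ1 : ‖ζ‖ < 1 := mem_ball_zero_iff.mp hζ
  have hβ1 : 0 < β + 1 := by linarith
  have hkernel := bergmanNorm_normalizedKernel_rpow_le hp hβ hkp hζ1
  set K := (2 : ℝ) ^ (|β| + k * p) / (β + 1)
  have hK : 0 < K := by positivity
  refine ⟨(differentiableOn_normalizedKernel hζ1).const_smul _, ?_⟩
  rw [bergmanNorm_const_smul hp, ← ENNReal.rpow_le_rpow_iff hp, ENNReal.one_rpow,
    ENNReal.mul_rpow_of_nonneg _ _ hp.le]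
  calc ‖((K ^ (-(1 / p)) : ℝ) : ℂ)‖ₑ ^ p * bergmanNorm p β (normalizedKernel ((2 + β) / p) k ζ) ^ p
      ≤ ENNReal.ofReal K⁻¹ * ENNReal.ofReal K := by
        gcongr
        rw [← ofReal_norm, Complex.norm_of_nonneg (by positivity),
          ENNReal.ofReal_rpow_of_nonneg (by positivity) hp.le, ← Real.rpow_mul hK.le, neg_mul,
          one_div_mul_cancel hp.ne', Real.rpow_neg_one]
    _ = 1 := by
        rw [← ENNReal.ofReal_mul (by positivity), inv_mul_cancel₀ hK.ne', ENNReal.ofReal_one]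

end BergmanKernel

end DiscInterp

end

theorem theorem2p1 (p : ℝ) (hp : 1 ≤ p) :
    (∃ a b : ℝ, 0 < a ∧ 0 < b ∧ ∀ (n : ℕ) (r : ℝ), 1 ≤ n → 0 ≤ r → r < 1 →
      ENNReal.ofReal (a * ((n : ℝ) / (1 - r)) ^ (1 / p)) ≤
        DiscInterp.worstInterpConst (DiscInterp.hardyNorm p) n r ∧
      DiscInterp.worstInterpConst (DiscInterp.hardyNorm p) n r ≤
        ENNReal.ofReal (b * ((n : ℝ) / (1 - r)) ^ (1 / p)) ∧
      ∀ z : ℂ, ‖z‖ = r →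
        ENNReal.ofReal (a * ((n : ℝ) / (1 - r)) ^ (1 / p)) ≤
          DiscInterp.interpConst (DiscInterp.hardyNorm p) (fun _ : Fin n => z)) ∧
    ∀ β : ℝ, -1 < β →
      ∃ a b : ℝ, 0 < a ∧ 0 < b ∧ ∀ (n : ℕ) (r : ℝ), 1 ≤ n → 0 ≤ r → r < 1 →
        ENNReal.ofReal (a * ((n : ℝ) / (1 - r)) ^ ((2 + β) / p)) ≤
          DiscInterp.worstInterpConst (DiscInterp.bergmanNorm p β) n r ∧
        DiscInterp.worstInterpConst (DiscInterp.bergmanNorm p β) n r ≤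
          ENNReal.ofReal (b * ((n : ℝ) / (1 - r)) ^ ((2 + β) / p)) ∧
        (∀ z : ℂ, ‖z‖ = r →
          ENNReal.ofReal (a * ((n : ℝ) / (1 - r)) ^ ((2 + β) / p)) ≤
            DiscInterp.interpConst (DiscInterp.bergmanNorm p β) (fun _ : Fin n => z)) ∧
        ENNReal.ofReal a *
            DiscInterp.evalNorm (DiscInterp.bergmanNorm p β) ((1 - (1 - r) / (n : ℝ) : ℝ) : ℂ) ≤
          DiscInterp.worstInterpConst (DiscInterp.bergmanNorm p β) n r ∧
        DiscInterp.worstInterpConst (DiscInterp.bergmanNorm p β) n r ≤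
          ENNReal.ofReal b *
            DiscInterp.evalNorm (DiscInterp.bergmanNorm p β)
              ((1 - (1 - r) / (n : ℝ) : ℝ) : ℂ) := by
  have hp0 : 0 < p := one_pos.trans_le hp
  refine ⟨?_, fun β hβ => ?_⟩
  · obtain ⟨a, b, ha, hb, h⟩ := DiscInterp.exists_interpConst_estimates
      (by positivity) one_pos (by positivity)
      (fun f hf w hw => DiscInterp.norm_le_of_mem_unitBall_hardyNorm hp hf hw)
      (fun ζ hζ => by
        rw [Complex.ofReal_one, one_smul]
        exact DiscInterp.normalizedKernel_mem_unitBall_hardyNorm hp hζ)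
    refine ⟨a, b, ha, hb, fun n r hn hr0 hr1 => ?_⟩
    obtain ⟨hlower, hupper, hconst, -⟩ := h n r hn hr0 hr1
    exact ⟨hlower, hupper, hconst⟩
  · obtain ⟨k, hk⟩ := exists_nat_ge (β + 3)
    have hkp : β + 3 ≤ k * p := by nlinarith
    have hβ1 : 0 < β + 1 := by linarith
    have hβ2 : 0 < 2 + β := by linarith
    exact DiscInterp.exists_interpConst_estimates (by positivity) (by positivity) (by positivity)
      (fun f hf w hw => DiscInterp.norm_le_of_mem_unitBall_bergmanNorm hp hf hw)
      (fun ζ hζ => DiscInterp.const_smul_normalizedKernel_mem_unitBall_bergmanNorm hp0 hβ hkp hζ)
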